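/- All graphs are finite, simple and undirected; graphs need not be connected. **Token sliding.** For independent sets $I,J$ of a graph $G$ write $I\to J$ if $I=J$, or if $I\setminus J=\{v_1\}$ and $J\setminus I=\{v_2\}$ for some edge $v_1v_2$ of $G$. The set $J$ is *reachable* from $I$ if there are independent sets $I=I_0\to I_1\to\dots\to I_k=J$ with $k\ge 0$. **Block graphs.** A *cut-vertex* of a graph is a vertex whose removal increases the number of connected components. A *block* of $G$ is a maximal vertex set $B$ such that $G[B]$ is connected, nonempty and has no cut-vertex. $G$ is a *block graph* if each of its blocks is a clique. Let $G$ be a block graph, $V_{cut}(G)$ its set of cut-vertices, and $\mathcal B_u(G)$ the set of its blocks that contain the vertex $u$. Let $\mathcal P_G$ be the set of all pairs $(u,B)$ and $(B,u)$ with $u\in V_{cut}(G)$ and $B\in\mathcal B_u(G)$; in both cases $u$ is the *base* of the pair. Let $G[u,B]$ (respectively $G[B,u]$) be the subgraph of $G$ induced by the vertex set of the connected component that contains $u$ in the graph obtained from $G$ by deleting all edges $uv$ with $v\in B$ (respectively with $v\notin B$). Let $\kappa(B,u)$ be the set of cut-vertices of $G[B,u]$ that lie in $B$, and $\beta(u,B)$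 the set of blocks of $G[u,B]$ that contain $u$. For $p\in\mathcal P_G$ and a set $C$ of vertices put $C[p]=C\cap V(G[p])$. **The values $ua$.** By recursion along the block-tree define a truth value $ua(p)$ for $p\in\mathcal P_G$: $ua(B,u)$ is true if $\kappa(B,u)=\emptyset$; if $\kappa(B,u)\ne\emptyset$, then $ua(B,u)$ is false exactly when $B=\kappa(B,u)\cup\{u\}$ and $ua(v,B)$ is true for all $v\in\kappa(B,u)$. And $ua(u,B)$ is true exactly when $ua(B',u)$ is true for some $B'\in\beta(u,B)$. In arithmetic expressions true counts as $1$ and false as $0$. **Capacity.** For $p\in\mathcal P_G$ and an independent set $C\subseteq V(G[p])$ define, by the same recursion, for $p=(B,u)$ $$cap_p(C)=\sum_{v\in\kappa(B,u)}cap_{(v,B)}(C[v,B])+ua(B,u)-|B\cap (C\setminus\{u\})|,$$ and for $p=(u,B)$ let $cap_p(C)=0$ if some $B'\in\beta(u,B)$ has $cap_{(B',u)}(C[B',u])=0$ and $ua(B',u)$ true, and otherwise $$cap_p(C)=\sum_{B'\in\beta(u,B)}\bigl(cap_{(B',u)}(C[B',u])-ua(B',u)\bigr)+ua(u,B).$$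 **Potential and rigidity.** For $p\in\mathcal P_G$ with base $u$ and an independent set $C$ of $G$ put $$pot_G(C,p)=\max\bigl\{cap_p(C'[p])+|C'[p]\setminus\{u\}|-|C[p]\setminus\{u\}| : C'\text{ is an independent set of }G\text{ reachable from }C\bigr\}.$$ A cut-vertex $u$ is *rigid for $C$* if there are two distinct blocks $B,B'\in\mathcal B_u(G)$ with $pot_G(C,(B,u))=pot_G(C,(B',u))=0$ and with $ua(B,u)$ and $ua(B',u)$ both true. **Theorem.** Let $G$ be a block graph and let $C_1,C_2$ be independent sets of $G$. Let $W_1$ and $W_2$ be the sets of cut-vertices of $G$ that are rigid for $C_1$ and for $C_2$, respectively. Then $C_1$ is reachable from $C_2$ if and only if $W_1=W_2$ and $|C_1\cap V(H)|=|C_2\cap V(H)|$ for every connected component $H$ of $G-W_1$. -/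

import Mathlib

namespace TokenSliding

/-! ## Token sliding -/

/-- `I → J`: both sets are independent, and either they are equal or `J` arises from `I` by
sliding one token along an edge. -/
def Step {V : Type*} (G : SimpleGraph V) (I J : Set V) : Prop :=
  G.IsIndepSet I ∧ G.IsIndepSet J ∧
    (I = J ∨ ∃ v₁ v₂ : V, I \ J = {v₁} ∧ J \ I = {v₂} ∧ G.Adj v₁ v₂)

/-- `ReachableFrom G I J`: the independent set `J` is reachable from the independent set `I`
by a finite (possibly empty) sequence of steps through independent sets. -/
def ReachableFrom {V : Type*} (G : SimpleGraph V) (I J : Set V) : Prop :=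
  G.IsIndepSet I ∧ Relation.ReflTransGen (Step G) I J

/-! ## Cut-vertices, blocks, block graphs

These notions are needed for `G` and for its induced subgraphs `G[S]`. They are written for `G[S]`,
with `S` a set of vertices of `G`; the case of `G` is `S = Set.univ`. -/

/-- The number of connected components of `G[S]`. -/
noncomputable def numComponents {V : Type*} (G : SimpleGraph V) (S : Set V) : ℕ :=
  Nat.card (G.induce S).ConnectedComponent

/-- The cut-vertices of `G[S]`: the vertices of `G[S]` whose removal increases the number of
connected components. -/
def cutVertices {V : Type*} (G : SimpleGraph V) (S : Set V) : Set V :=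
  {u | u ∈ S ∧ numComponents G S < numComponents G (S \ {u})}

/-- `G[S]` is 2-connected: it is connected (and nonempty) and has no cut-vertex. -/
def IsTwoConnected {V : Type*} (G : SimpleGraph V) (S : Set V) : Prop :=
  (G.induce S).Connected ∧ cutVertices G S = ∅

/-- The blocks of `G[S]`: the maximal vertex sets that induce a 2-connected subgraph. -/
def blocks {V : Type*} (G : SimpleGraph V) (S : Set V) : Set (Set V) :=
  {B | Maximal (fun T : Set V => T ⊆ S ∧ IsTwoConnected G T) B}

/-- A block graph is a graph in which every block is a clique. -/
def IsBlockGraph {V : Type*} (G : SimpleGraph V) : Prop :=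
  ∀ B ∈ blocks G Set.univ, G.IsClique B

/-! ## Arcs of the block-tree and the branches they determine -/

/-- A pair `(B, u)` or `(u, B)` consisting of a vertex and a set of vertices. -/
inductive Arc (V : Type*) where
  /-- the pair `(B, u)` -/
  | toVertex (B : Set V) (u : V) : Arc V
  /-- the pair `(u, B)` -/
  | toBlock (u : V) (B : Set V) : Arc V

/-- The base `u` of `(B, u)` and of `(u, B)`. -/
def Arc.base {V : Type*} : Arc V → V
  | .toVertex _ u => u
  | .toBlock u _ => u

/-- The block `B` of `(B, u)` and of `(u, B)`. -/
def Arc.block {V : Type*} : Arc V → Set V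
  | .toVertex B _ => B
  | .toBlock _ B => B

/-- The arcs `(u, B)` and `(B, u)`, where `u` is a cut-vertex of `G` and `B` is a block of `G`
that contains `u`. -/
def arcs {V : Type*} (G : SimpleGraph V) : Set (Arc V) :=
  {p | p.base ∈ cutVertices G Set.univ ∧ p.block ∈ blocks G Set.univ ∧ p.base ∈ p.block}

/-- The vertex set of `G[p]`. For `p = (B, u)` (respectively `p = (u, B)`) it is the connected
component of `u` after deleting all edges `uv` with `v ∉ B` (respectively with `v ∈ B`). -/
def branch {V : Type*} (G : SimpleGraph V) : Arc V → Set V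
  | .toVertex B u => {w | (G.deleteEdges {e | ∃ v, v ∉ B ∧ e = s(u, v)}).Reachable u w}
  | .toBlock u B => {w | (G.deleteEdges {e | ∃ v, v ∈ B ∧ e = s(u, v)}).Reachable u w}

/-- `κ(B, u)`: the cut-vertices of `G[B, u]` that belong to `B`. -/
def kappa {V : Type*} (G : SimpleGraph V) (B : Set V) (u : V) : Set V :=
  B ∩ cutVertices G (branch G (.toVertex B u))

/-- `β(u, B)`: the blocks of `G[u, B]` that contain `u`. -/
def beta {V : Type*} (G : SimpleGraph V) (u : V) (B : Set V) : Set (Set V) :=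
  {B' | B' ∈ blocks G (branch G (.toBlock u B)) ∧ u ∈ B'}

/-! ## Well-foundedness of the recursion along the block-tree -/

lemma preconnected_induce_iff_walk {V : Type*} {G : SimpleGraph V} {S : Set V} :
    (G.induce S).Preconnected ↔
      ∀ x ∈ S, ∀ y ∈ S, ∃ p : G.Walk x y, ∀ z ∈ p.support, z ∈ S := by
  constructor
  · intro h x hx y hy
    obtain ⟨q⟩ := h ⟨x, hx⟩ ⟨y, hy⟩
    have key : ∀ {a b : S} (r : (G.induce S).Walk a b),
        ∃ p : G.Walk a.1 b.1, ∀ z ∈ p.support, z ∈ S := by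
      intro a b r
      induction r with
      | nil => exact ⟨.nil, by simp⟩
      | @cons a' b' c' hadj r ih =>
        obtain ⟨p, hp⟩ := ih
        refine ⟨SimpleGraph.Walk.cons (SimpleGraph.induce_adj.1 hadj) p, ?_⟩
        intro z hz
        rw [SimpleGraph.Walk.support_cons, List.mem_cons] at hz
        rcases hz with rfl | hz
        · exact a'.2
        · exact hp z hz
    exact key q
  · rintro h ⟨x, hx⟩ ⟨y, hy⟩
    obtain ⟨p, hp⟩ := h x hx y hy
    exact ⟨p.induce S hp⟩

lemma maximal_of_mem_blocks {V : Type*} {G : SimpleGraph V} {S B : Set V} (h : B ∈ blocks G S) :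
    Maximal (fun T : Set V => T ⊆ S ∧ IsTwoConnected G T) B := h

lemma IsTwoConnected.sdiff {V : Type*} [Finite V] {G : SimpleGraph V} {B : Set V}
    (h : IsTwoConnected G B) (x : V) : (G.induce (B \ {x})).Preconnected := by
  by_cases hx : x ∈ B
  · have hc : ¬ numComponents G B < numComponents G (B \ {x}) := fun hlt =>
      (Set.eq_empty_iff_forall_notMem.1 h.2 x) ⟨hx, hlt⟩
    have : Subsingleton (G.induce B).ConnectedComponent :=
      h.1.preconnected.subsingleton_connectedComponent
    have h1 : numComponents G B ≤ 1 := Finite.card_le_one_iff_subsingleton.2 this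
    have h2 : numComponents G (B \ {x}) ≤ 1 := by omega
    have h3 := Finite.card_le_one_iff_subsingleton.1 h2
    intro a b
    exact SimpleGraph.ConnectedComponent.eq.1 (Subsingleton.elim _ _)
  · rw [Set.sdiff_singleton_eq_self hx]
    exact h.1.preconnected

lemma notMem_cutVertices {V : Type*} [Finite V] {G : SimpleGraph V} {S : Set V} {x : V}
    (h : (G.induce (S \ {x})).Preconnected) : x ∉ cutVertices G S := by
  rintro ⟨hx, hlt⟩
  have h2 : numComponents G (S \ {x}) ≤ 1 :=
    Finite.card_le_one_iff_subsingleton.2 h.subsingleton_connectedComponent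
  have : Nonempty (G.induce S).ConnectedComponent :=
    ⟨(G.induce S).connectedComponentMk ⟨x, hx⟩⟩
  have h1 : 0 < numComponents G S := Finite.card_pos
  omega

lemma branch_toBlock_inter {V : Type*} [Finite V] {G : SimpleGraph V} {B : Set V} {u w : V}
    (hB : B ∈ blocks G Set.univ) (hu : u ∈ B) (hw : w ∈ B)
    (hwr : w ∈ branch G (.toBlock u B)) : w = u := by
  by_contra hne
  have hle : G.deleteEdges {e | ∃ v, v ∈ B ∧ e = s(u, v)} ≤ G := G.deleteEdges_le _
  obtain ⟨p', hp'⟩ := SimpleGraph.Reachable.exists_isPath hwr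
  have hp : (p'.mapLe hle).IsPath := hp'.mapLe hle
  have hsupp : (p'.mapLe hle).support = p'.support := by simp
  set p := p'.mapLe hle with hpdef
  have h2 : IsTwoConnected G B := (maximal_of_mem_blocks hB).prop.2
  set S : Set V := B ∪ {x | x ∈ p.support} with hS
  -- every vertex of the path reaches `B` inside the path while avoiding a given vertex
  have key : ∀ x y, y ∈ S → y ≠ x → ∃ b ∈ B, b ≠ x ∧
      ∃ q : G.Walk y b, ∀ z ∈ q.support, z ∈ S \ {x} := by
    intro x y hy hyx
    rcases hy with hy | hy
    · exact ⟨y, hy, hyx, .nil, by simp [hS, hy, hyx]⟩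
    · classical
      have hy : y ∈ p.support := hy
      by_cases hx : x ∈ (p.takeUntil y hy).support
      · have hx2 : x ∉ (p.dropUntil y hy).support := by
          intro hx2
          have hap : ((p.takeUntil y hy).append (p.dropUntil y hy)).IsPath := by
            rw [SimpleGraph.Walk.take_spec]; exact hp
          have hnd := hap.support_nodup
          rw [SimpleGraph.Walk.support_append] at hnd
          have hxt : x ∈ (p.dropUntil y hy).support.tail := by
            rw [SimpleGraph.Walk.mem_support_iff] at hx2
            exact hx2.resolve_left (Ne.symm hyx)
          exact (List.disjoint_of_nodup_append hnd) hx hxt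
        refine ⟨w, hw, ?_, p.dropUntil y hy, ?_⟩
        · rintro rfl
          exact hx2 (SimpleGraph.Walk.end_mem_support _)
        · intro z hz
          refine ⟨Or.inr (p.support_dropUntil_subset_support hy hz), ?_⟩
          rintro rfl
          exact hx2 hz
      · refine ⟨u, hu, ?_, (p.takeUntil y hy).reverse, ?_⟩
        · rintro rfl
          exact hx (SimpleGraph.Walk.start_mem_support _)
        · intro z hz
          rw [SimpleGraph.Walk.support_reverse, List.mem_reverse] at hz
          refine ⟨Or.inr (p.support_takeUntil_subset_support hy hz), ?_⟩
          rintro rfl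
          exact hx hz
  have hpre : ∀ x, (G.induce (S \ {x})).Preconnected := by
    intro x
    rw [preconnected_induce_iff_walk]
    rintro y ⟨hy, hyx⟩ y' ⟨hy', hyx'⟩
    obtain ⟨b, hb, hbx, q, hq⟩ := key x y hy hyx
    obtain ⟨b', hb', hbx', q', hq'⟩ := key x y' hy' hyx'
    obtain ⟨r, hr⟩ := preconnected_induce_iff_walk.1 (h2.sdiff x) b ⟨hb, hbx⟩ b' ⟨hb', hbx'⟩
    refine ⟨q.append (r.append q'.reverse), ?_⟩
    intro z hz
    rw [SimpleGraph.Walk.mem_support_append_iff, SimpleGraph.Walk.mem_support_append_iff,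
      SimpleGraph.Walk.support_reverse, List.mem_reverse] at hz
    rcases hz with hz | hz | hz
    · exact hq z hz
    · exact ⟨Or.inl (hr z hz).1, (hr z hz).2⟩
    · exact hq' z hz
  have hconn : (G.induce S).Connected := by
    have huS : u ∈ S := Or.inl hu
    have hto : ∀ y ∈ S, ∃ q : G.Walk u y, ∀ z ∈ q.support, z ∈ S := by
      intro y hy
      rcases hy with hy | hy
      · obtain ⟨q, hq⟩ := preconnected_induce_iff_walk.1 h2.1.preconnected u hu y hy
        exact ⟨q, fun z hz => Or.inl (hq z hz)⟩
      · classical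
        have hy : y ∈ p.support := hy
        exact ⟨p.takeUntil y hy, fun z hz => Or.inr (p.support_takeUntil_subset_support hy hz)⟩
    have : Nonempty S := ⟨⟨u, huS⟩⟩
    refine SimpleGraph.Connected.mk (preconnected_induce_iff_walk.2 ?_)
    intro x hx y hy
    obtain ⟨q, hq⟩ := hto x hx
    obtain ⟨q', hq'⟩ := hto y hy
    refine ⟨q.reverse.append q', ?_⟩
    intro z hz
    rw [SimpleGraph.Walk.mem_support_append_iff, SimpleGraph.Walk.support_reverse,
      List.mem_reverse] at hz
    exact hz.elim (hq z) (hq' z)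
  have hS2 : IsTwoConnected G S :=
    ⟨hconn, Set.eq_empty_iff_forall_notMem.2 fun x => notMem_cutVertices (hpre x)⟩
  have hSB : S ⊆ B := (maximal_of_mem_blocks hB).le_of_ge ⟨Set.subset_univ _, hS2⟩ Set.subset_union_left
  have hin : ∀ z ∈ p'.support, z ∈ B := by
    intro z hz
    exact hSB (Or.inr (by rw [← hsupp] at hz; exact hz))
  cases p' with
  | nil => exact hne rfl
  | cons hadj q =>
    rename_i v
    have hv : v ∈ B := hin v (by simp)
    rw [SimpleGraph.deleteEdges_adj] at hadj
    exact hadj.2 ⟨v, hv, rfl⟩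

lemma branch_toVertex_subset {V : Type*} [Finite V] {G : SimpleGraph V} {B B' : Set V} {u : V}
    (hB : B ∈ blocks G Set.univ) (hu : u ∈ B) (hB' : B' ∈ beta G u B) :
    branch G (.toVertex B' u) ⊆ branch G (.toBlock u B) := by
  intro w hw
  refine SimpleGraph.Reachable.mono ?_ hw
  intro a b hab
  rw [SimpleGraph.deleteEdges_adj] at hab ⊢
  refine ⟨hab.1, ?_⟩
  rintro ⟨v, hv, he⟩
  by_cases hv' : v ∈ B'
  · have : v = u := branch_toBlock_inter hB hu hv ((maximal_of_mem_blocks hB'.1).prop.1 hv')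
    subst this
    have hd : s(a, b).IsDiag := by rw [he]; simp
    exact hab.1.ne (by simpa using hd)
  · exact hab.2 ⟨v, hv', he⟩

lemma subset_branch_toVertex {V : Type*} {G : SimpleGraph V} {B : Set V} {u : V}
    (hB : B ∈ blocks G Set.univ) (hu : u ∈ B) : B ⊆ branch G (.toVertex B u) := by
  intro w hw
  have h := (maximal_of_mem_blocks hB).prop.2.1.preconnected ⟨u, hu⟩ ⟨w, hw⟩
  let f : G.induce B →g G.deleteEdges {e | ∃ v, v ∉ B ∧ e = s(u, v)} :=
    { toFun := fun x => x.1
      map_rel' := by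
        rintro ⟨a, ha⟩ ⟨b, hb⟩ hab
        rw [SimpleGraph.deleteEdges_adj]
        refine ⟨hab, ?_⟩
        rintro ⟨v, hv, he⟩
        have : v ∈ s(a, b) := by rw [he]; simp
        rcases Sym2.mem_iff.1 this with rfl | rfl
        · exact hv ha
        · exact hv hb }
  exact h.map f

lemma base_notMem_kappa {V : Type*} [Finite V] {G : SimpleGraph V} {B : Set V} {u : V}
    (hB : B ∈ blocks G Set.univ) (hu : u ∈ B) : u ∉ kappa G B u := by
  rintro ⟨-, hcut⟩
  refine notMem_cutVertices ?_ hcut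
  have hle : G.deleteEdges {e | ∃ v, v ∉ B ∧ e = s(u, v)} ≤ G := G.deleteEdges_le _
  have key : ∀ y ∈ branch G (.toVertex B u) \ {u}, ∃ b ∈ B, b ≠ u ∧
      ∃ q : G.Walk b y, ∀ z ∈ q.support, z ∈ branch G (.toVertex B u) \ {u} := by
    rintro y ⟨hy, hyu⟩
    obtain ⟨p, hp⟩ := SimpleGraph.Reachable.exists_isPath hy
    cases p with
    | nil => exact absurd rfl hyu
    | cons hadj q =>
      rename_i v
      have hadj' := hadj
      rw [SimpleGraph.deleteEdges_adj] at hadj'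
      rw [SimpleGraph.Walk.cons_isPath_iff] at hp
      refine ⟨v, ?_, hadj'.1.ne', q.mapLe hle, ?_⟩
      · by_contra hv
        exact hadj'.2 ⟨v, hv, rfl⟩
      · intro z hz
        have hz : z ∈ q.support := by simpa using hz
        classical
        refine ⟨hadj.reachable.trans (q.takeUntil z hz).reachable, ?_⟩
        rintro rfl
        exact hp.2 hz
  rw [preconnected_induce_iff_walk]
  intro x hx y hy
  obtain ⟨b, hb, hbu, q, hq⟩ := key x hx
  obtain ⟨b', hb', hbu', q', hq'⟩ := key y hy
  obtain ⟨r, hr⟩ :=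
    preconnected_induce_iff_walk.1 ((maximal_of_mem_blocks hB).prop.2.sdiff u) b ⟨hb, hbu⟩ b' ⟨hb', hbu'⟩
  refine ⟨q.reverse.append (r.append q'), ?_⟩
  intro z hz
  rw [SimpleGraph.Walk.mem_support_append_iff, SimpleGraph.Walk.mem_support_append_iff,
    SimpleGraph.Walk.support_reverse, List.mem_reverse] at hz
  rcases hz with hz | hz | hz
  · exact hq z hz
  · exact ⟨subset_branch_toVertex hB hu (hr z hz).1, (hr z hz).2⟩
  · exact hq' z hz

lemma branch_toBlock_ssubset {V : Type*} [Finite V] {G : SimpleGraph V} {B : Set V} {u v : V}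
    (hB : B ∈ blocks G Set.univ) (hu : u ∈ B) (hv : v ∈ kappa G B u) :
    branch G (.toBlock v B) ⊂ branch G (.toVertex B u) := by
  have hvB : v ∈ B := hv.1
  have hvu : v ≠ u := by
    rintro rfl
    exact base_notMem_kappa hB hu hv
  have hun : u ∉ branch G (.toBlock v B) := fun h =>
    hvu (branch_toBlock_inter hB hvB hu h).symm
  refine (Set.ssubset_iff_of_subset ?_).2 ⟨u, SimpleGraph.Reachable.refl _, hun⟩
  intro y hy
  refine SimpleGraph.Reachable.trans (subset_branch_toVertex hB hu hvB) ?_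
  obtain ⟨p⟩ := hy
  have hns : u ∉ p.support := by
    intro h
    classical
    exact hun (p.takeUntil u h).reachable
  have key : ∀ {a b : V} (q : (G.deleteEdges {e | ∃ w, w ∈ B ∧ e = s(v, w)}).Walk a b),
      u ∉ q.support → (G.deleteEdges {e | ∃ w, w ∉ B ∧ e = s(u, w)}).Reachable a b := by
    intro a b q
    induction q with
    | nil => exact fun _ => SimpleGraph.Reachable.refl _
    | @cons a b c hadj q ih =>
      intro hs
      rw [SimpleGraph.Walk.support_cons, List.mem_cons, not_or] at hs
      refine SimpleGraph.Reachable.trans (SimpleGraph.Adj.reachable ?_) (ih hs.2)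
      rw [SimpleGraph.deleteEdges_adj] at hadj ⊢
      refine ⟨hadj.1, ?_⟩
      rintro ⟨w, -, he⟩
      have hmem : u ∈ s(a, b) := by rw [he]; simp
      rcases Sym2.mem_iff.1 hmem with rfl | rfl
      · exact hs.1 rfl
      · exact hs.2 q.start_mem_support
  exact key p hns

/-- The rank of an arc, which decreases along the recursions below. -/
noncomputable def rank {V : Type*} (G : SimpleGraph V) : Arc V → ℕ
  | .toVertex B u => 2 * (branch G (.toVertex B u)).ncard
  | .toBlock u B => 2 * (branch G (.toBlock u B)).ncard + 1

lemma rank_toBlock_lt {V : Type*} [Finite V] {G : SimpleGraph V} {B : Set V} {u v : V}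
    (h : Arc.toVertex B u ∈ arcs G) (hv : v ∈ kappa G B u) :
    rank G (.toBlock v B) < rank G (.toVertex B u) := by
  have : (branch G (.toBlock v B)).ncard < (branch G (.toVertex B u)).ncard :=
    Set.ncard_lt_ncard (branch_toBlock_ssubset h.2.1 h.2.2 hv) (Set.toFinite _)
  simp only [rank]
  omega

lemma rank_toVertex_lt {V : Type*} [Finite V] {G : SimpleGraph V} {B B' : Set V} {u : V}
    (h : Arc.toBlock u B ∈ arcs G) (hB' : B' ∈ beta G u B) :
    rank G (.toVertex B' u) < rank G (.toBlock u B) := by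
  have : (branch G (.toVertex B' u)).ncard ≤ (branch G (.toBlock u B)).ncard :=
    Set.ncard_le_ncard (branch_toVertex_subset h.2.1 h.2.2 hB') (Set.toFinite _)
  simp only [rank]
  omega

/-! ## The values `ua`, capacities, potentials, rigid vertices -/

/-- The Boolean value `ua(p)` of an arc `p` of the block-tree (`False` if `p` is not such an arc).
The arcs of depth zero are the arcs `(B, u)` with `κ(B, u) = ∅`. -/
def ua {V : Type*} [Finite V] (G : SimpleGraph V) : Arc V → Prop
  | .toVertex B u => ∃ _ : Arc.toVertex B u ∈ arcs G,
      kappa G B u = ∅ ∨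
        ¬ ((∀ v : kappa G B u, ua G (.toBlock v.1 B)) ∧ B = kappa G B u ∪ {u})
  | .toBlock u B => ∃ _ : Arc.toBlock u B ∈ arcs G,
      ∃ B' : beta G u B, ua G (.toVertex B'.1 u)
termination_by p => rank G p
decreasing_by
  · exact rank_toBlock_lt ‹_› v.2
  · exact rank_toVertex_lt ‹_› B'.2

open Classical in
/-- `ua(p)` as a number: 1 for true and 0 for false. -/
noncomputable def uaNum {V : Type*} [Finite V] (G : SimpleGraph V) (p : Arc V) : ℤ :=
  if ua G p then 1 else 0

open Classical in
/-- The capacity `cap(C)` of a `p`-independent set `C`, for an arc `p` of the block-tree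
(0 if `p` is not such an arc). Here `C[q]` is `C ∩ branch G q`. -/
noncomputable def cap {V : Type*} [Finite V] (G : SimpleGraph V) : Arc V → Set V → ℤ
  | .toVertex B u, C =>
      if _h : Arc.toVertex B u ∈ arcs G then
        (∑ᶠ v : kappa G B u, cap G (.toBlock v.1 B) (C ∩ branch G (.toBlock v.1 B)))
          + uaNum G (.toVertex B u) - ((B ∩ (C \ {u})).ncard : ℤ)
      else 0
  | .toBlock u B, C =>
      if _h : Arc.toBlock u B ∈ arcs G then
        if ∃ B' : beta G u B,
            cap G (.toVertex B'.1 u) (C ∩ branch G (.toVertex B'.1 u)) = 0 ∧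
              ua G (.toVertex B'.1 u) then 0
        else
          (∑ᶠ B' : beta G u B,
            (cap G (.toVertex B'.1 u) (C ∩ branch G (.toVertex B'.1 u))
              - uaNum G (.toVertex B'.1 u)))
            + uaNum G (.toBlock u B)
      else 0
termination_by p _ => rank G p
decreasing_by
  · exact rank_toBlock_lt ‹_› v.2
  · exact rank_toVertex_lt ‹_› B'.2
  · exact rank_toVertex_lt ‹_› B'.2

/-- The values over which the potential is the maximum: `cap(C'[p]) + |C'[p] \ {u}| - |C[p] \ {u}|`
for the independent sets `C'` reachable from `C`, where `u` is the base of `p`. -/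
def potValues {V : Type*} [Finite V] (G : SimpleGraph V) (C : Set V) (p : Arc V) : Set ℤ :=
  {x | ∃ C' : Set V, ReachableFrom G C C' ∧
    x = cap G p (C' ∩ branch G p) + (((C' ∩ branch G p) \ {p.base}).ncard : ℤ)
      - (((C ∩ branch G p) \ {p.base}).ncard : ℤ)}

/-- The potential of `p` with respect to the independent set `C`. -/
noncomputable def pot {V : Type*} [Finite V] (G : SimpleGraph V) (C : Set V) (p : Arc V) : ℤ :=
  sSup (potValues G C p)

/-- The potential is a maximum that is attained. -/
lemma isGreatest_pot {V : Type*} [Finite V] (G : SimpleGraph V) {C : Set V}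
    (hC : G.IsIndepSet C) (p : Arc V) : IsGreatest (potValues G C p) (pot G C p) := by
  have hfin : (potValues G C p).Finite := by
    refine (Set.finite_range (fun C' : Set V =>
      cap G p (C' ∩ branch G p) + (((C' ∩ branch G p) \ {p.base}).ncard : ℤ)
      - (((C ∩ branch G p) \ {p.base}).ncard : ℤ))).subset ?_
    rintro x ⟨C', -, rfl⟩
    exact ⟨C', rfl⟩
  have hne : (potValues G C p).Nonempty := ⟨_, C, ⟨hC, Relation.ReflTransGen.refl⟩, rfl⟩
  exact ⟨Int.csSup_mem hne hfin.bddAbove, fun x hx => le_csSup hfin.bddAbove hx⟩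

/-- The set of cut-vertices of `G` that are rigid for `C`. -/
def rigid {V : Type*} [Finite V] (G : SimpleGraph V) (C : Set V) : Set V :=
  {u | u ∈ cutVertices G Set.univ ∧
    ∃ B ∈ blocks G Set.univ, ∃ B' ∈ blocks G Set.univ, u ∈ B ∧ u ∈ B' ∧ B ≠ B' ∧
      pot G C (.toVertex B u) = 0 ∧ pot G C (.toVertex B' u) = 0 ∧
      ua G (.toVertex B u) ∧ ua G (.toVertex B' u)}

end TokenSliding

namespace TokenSliding

/-! ## Slides inside a set of vertices -/

section Slides

variable {V : Type*} {G : SimpleGraph V}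

/-! A block graph is used only through `LocallyBlock`: neighbours of `u` that are joined in `G - u`
are adjacent. This makes blocks maximal cliques, and it separates the parts of the graph that hang
at a vertex.

Necessity. The capacity of an arc measures how many tokens its branch can still take in through the
base. It is never negative (`LocallyBlock.cap_nonneg`), and if `ua(B, u)` is true, then it is
positive whenever `u` is occupied. Let `u` be rigid because of `B` and `B'`. As long as `u` is
empty, the token counts on its two sides are constant. A slide onto `u` would leave the count on at
least one of these sides unchanged, so potential zero would force capacity zero there while `u` is
occupied. Hence rigid vertices are never occupied (`LocallyBlock.rigid_unoccupied`). All slides then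
take place outside them, so that the token counts in the components, the potentials at rigid
vertices and the set of rigid vertices are invariant.

Sufficiency. Capacity can be realised by slides (`LocallyBlock.clearable_and_absorbable`): if `ua`
is false or the capacity is positive, the branch can clear the neighbours of its base, and with
positive capacity it can swallow a token from its base. Consequently the closed neighbourhood of a
vertex that is not rigid can be brought to hold at most one token
(`LocallyBlock.exists_reach_subsingleton`). If this is possible at every vertex of a connected
piece, tokens can be carried to any vertex, and two configurations of the same size are linked by
induction (`Unstuck.reach`): park a token in the leaf blocks at some `u`, cut these blocks off
together with `u`, and continue with the rest.

The crux is that the rest is still unstuck, although the slides that show this may have used the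
parked token. This rests on `LocallyBlock.deletable`: a token at the same vertex at the beginning
and at the end of a reconfiguration is not needed for the others. -/

lemma indep_iff {S : Set V} : G.IsIndepSet S ↔ ∀ x ∈ S, ∀ y ∈ S, ¬ G.Adj x y := by
  constructor
  · intro h x hx y hy hxy
    exact h hx hy hxy.ne hxy
  · intro h x hx y hy _
    exact h x hx y hy

/-- `J` arises from `I` by sliding a token along an edge of `G[X]`. -/
def SlideIn (G : SimpleGraph V) (X I J : Set V) : Prop :=
  G.IsIndepSet I ∧ G.IsIndepSet J ∧
    ∃ a ∈ I, ∃ b, b ∉ I ∧ a ∈ X ∧ b ∈ X ∧ G.Adj a b ∧ J = insert b (I \ {a})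

/-- `J` arises from `I` by finitely many slides along edges of `G[X]`. -/
def Reach (G : SimpleGraph V) (X : Set V) : Set V → Set V → Prop :=
  Relation.ReflTransGen (SlideIn G X)

lemma Reach.refl {X I : Set V} : Reach G X I I := Relation.ReflTransGen.refl

lemma Reach.trans {X I J K : Set V} (h : Reach G X I J) (h' : Reach G X J K) : Reach G X I K :=
  Relation.ReflTransGen.trans h h'

lemma SlideIn.reach {X I J : Set V} (h : SlideIn G X I J) : Reach G X I J :=
  Relation.ReflTransGen.single h

lemma SlideIn.symm {X I J : Set V} (h : SlideIn G X I J) : SlideIn G X J I := by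
  obtain ⟨hI, hJ, a, ha, b, hb, haX, hbX, hab, rfl⟩ := h
  refine ⟨hJ, hI, b, by simp, a, ?_, hbX, haX, hab.symm, ?_⟩
  · simp [hab.ne]
  · ext x; grind

lemma Reach.symm {X I J : Set V} (h : Reach G X I J) : Reach G X J I := by
  induction h with
  | refl => exact .refl
  | tail _ h ih => exact Relation.ReflTransGen.head h.symm ih

lemma SlideIn.mono {X Y I J : Set V} (hXY : X ⊆ Y) (h : SlideIn G X I J) : SlideIn G Y I J := by
  obtain ⟨hI, hJ, a, ha, b, hb, haX, hbX, hab, rfl⟩ := h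
  exact ⟨hI, hJ, a, ha, b, hb, hXY haX, hXY hbX, hab, rfl⟩

lemma Reach.mono {X Y I J : Set V} (hXY : X ⊆ Y) (h : Reach G X I J) : Reach G Y I J := by
  induction h with
  | refl => exact .refl
  | tail _ h ih => exact Relation.ReflTransGen.tail ih (h.mono hXY)

lemma Reach.indep {X I J : Set V} (h : Reach G X I J) (hI : G.IsIndepSet I) :
    G.IsIndepSet J := by
  induction h with
  | refl => exact hI
  | tail _ h _ => exact h.2.1

lemma Reach.sdiff_eq {X I J : Set V} (h : Reach G X I J) : I \ X = J \ X := by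
  induction h with
  | refl => rfl
  | tail _ h ih =>
    obtain ⟨-, -, a, ha, b, hb, haX, hbX, hab, rfl⟩ := h
    rw [ih]; ext x; grind

lemma Reach.mem_iff {X I J : Set V} (h : Reach G X I J) {x : V} (hx : x ∉ X) :
    x ∈ I ↔ x ∈ J := by
  have := Set.ext_iff.1 h.sdiff_eq x
  simpa [hx] using this

lemma Reach.subset {X I J : Set V} (h : Reach G X I J) (hI : I ⊆ X) : J ⊆ X := by
  intro x hx
  by_contra hxX
  exact hxX (hI ((h.mem_iff hxX).2 hx))

/-- Slides in a set `X` that is closed under adjacency in `Y` do not depend on the tokens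
outside `X`. -/
lemma Reach.project {X Y Z C C' : Set V} (h : Reach G Y C C')
    (hXY : ∀ x ∈ X, ∀ y ∈ Y, G.Adj x y → y ∈ X)
    (hZ : G.IsIndepSet Z) (hXZ : ∀ x ∈ X, ∀ z ∈ Z, ¬ G.Adj x z) (hd : ∀ z ∈ Z, z ∉ X) :
    Reach G (X ∩ Y) (C ∩ X ∪ Z) (C' ∩ X ∪ Z) := by
  rw [indep_iff] at hZ
  have hind : ∀ D, G.IsIndepSet D → G.IsIndepSet (D ∩ X ∪ Z) := by
    intro D hD
    rw [indep_iff] at hD ⊢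
    rintro x hx y hy hxy
    have := hxy.symm
    rcases hx with hx | hx <;> rcases hy with hy | hy <;> grind
  induction h with
  | refl => exact .refl
  | @tail D D' _ hs ih =>
    refine ih.trans ?_
    obtain ⟨hI, hJ, a, ha, b, hb, haY, hbY, hab, rfl⟩ := hs
    by_cases haX : a ∈ X
    · have hbX := hXY a haX b hbY hab
      refine SlideIn.reach ⟨hind _ hI, hind _ hJ, a, ?_, b, ?_, ⟨haX, haY⟩, ⟨hbX, hbY⟩, hab, ?_⟩
      · grind
      · grind
      · ext x; grind
    · have hbX : b ∉ X := fun hbX => haX (hXY b hbX a haY hab.symm)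
      have : insert b (D \ {a}) ∩ X = D ∩ X := by ext x; grind
      rw [this]
      exact .refl

/-- Add tokens that do not interact with `X`. -/
lemma Reach.frame {X Z C C' : Set V} (h : Reach G X C C') (hC : C ⊆ X)
    (hZ : G.IsIndepSet Z) (hXZ : ∀ x ∈ X, ∀ z ∈ Z, ¬ G.Adj x z) (hd : ∀ z ∈ Z, z ∉ X) :
    Reach G X (C ∪ Z) (C' ∪ Z) := by
  have := h.project (X := X) (fun _ _ y hy _ => hy) hZ hXZ hd
  rwa [Set.inter_self, Set.inter_eq_left.2 hC, Set.inter_eq_left.2 (h.subset hC)] at this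

lemma Reach.ncard_inter [Finite V] {X Y C C' : Set V} (h : Reach G Y C C')
    (hXY : ∀ x ∈ X, ∀ y ∈ Y, G.Adj x y → y ∈ X) : (C ∩ X).ncard = (C' ∩ X).ncard := by
  induction h with
  | refl => rfl
  | @tail D D' _ hs ih =>
    rw [ih]
    obtain ⟨hI, hJ, a, ha, b, hb, haY, hbY, hab, rfl⟩ := hs
    by_cases haX : a ∈ X
    · have hbX := hXY a haX b hbY hab
      have h1 : insert b (D \ {a}) ∩ X = insert b ((D ∩ X) \ {a}) := by ext x; grind
      rw [h1, Set.ncard_exchange (by grind) (by grind)]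
    · have hbX : b ∉ X := fun hbX => haX (hXY b hbX a haY hab.symm)
      have : insert b (D \ {a}) ∩ X = D ∩ X := by ext x; grind
      rw [this]

lemma Reach.ncard_eq [Finite V] {Y C C' : Set V} (h : Reach G Y C C') : C.ncard = C'.ncard := by
  simpa using h.ncard_inter (X := Set.univ) (by simp)

/-- If the vertices outside `Y` are never occupied, then all slides take place in `Y`. -/
lemma Reach.restrict {X Y C C' : Set V} (h : Reach G X C C')
    (hY : ∀ D, Reach G X C D → D ⊆ Y) : Reach G (X ∩ Y) C C' := by
  induction h with
  | refl => exact .refl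
  | @tail D D' hD hs ih =>
    refine ih.trans (SlideIn.reach ?_)
    have h1 := hY D hD
    have h2 := hY D' (Reach.trans hD hs.reach)
    obtain ⟨hI, hJ, a, ha, b, hb, haX, hbX, hab, rfl⟩ := hs
    exact ⟨hI, hJ, a, ha, b, hb, ⟨haX, h1 ha⟩, ⟨hbX, h2 (by simp)⟩, hab, rfl⟩

/-- After removing a token, the other tokens can still make their moves. -/
lemma Reach.remove {X S C : Set V} {v : V} (h : Reach G X (insert v S) C) (hv : v ∉ S) :
    ∃ z ∈ C, Reach G X S (C \ {z}) := by
  generalize hT : insert v S = T at h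
  induction h with
  | refl => subst hT; exact ⟨v, by simp, by simp [hv, Reach.refl]⟩
  | @tail D D' hD hs ih =>
    obtain ⟨z, hz, hr⟩ := ih
    obtain ⟨hI, hJ, a, ha, b, hb, haX, hbX, hab, rfl⟩ := hs
    by_cases haz : z = a
    · subst haz
      refine ⟨b, by simp, ?_⟩
      have : insert b (D \ {z}) \ {b} = D \ {z} := by ext x; grind
      rwa [this]
    · refine ⟨z, by grind, hr.trans (SlideIn.reach ⟨?_, ?_, a, by grind, b, by grind, haX, hbX, hab, ?_⟩)⟩
      · exact hI.mono Set.sdiff_subset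
      · exact hJ.mono Set.sdiff_subset
      · ext x; grind

lemma reachableFrom_iff {C C' : Set V} (hC : G.IsIndepSet C) :
    ReachableFrom G C C' ↔ Reach G Set.univ C C' := by
  constructor
  · rintro ⟨-, h⟩
    induction h with
    | refl => exact .refl
    | @tail D D' _ hs ih =>
      obtain ⟨h1, h2, rfl | ⟨a, b, ha, hb, hab⟩⟩ := hs
      · exact ih
      · refine ih.trans (SlideIn.reach ⟨h1, h2, a, ?_, b, ?_, trivial, trivial, hab, ?_⟩)
        · exact (ha.ge rfl).1
        · exact (hb.ge rfl).2
        · ext x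
          have h3 := Set.ext_iff.1 ha x
          have h4 := Set.ext_iff.1 hb x
          grind
  · intro h
    refine ⟨hC, ?_⟩
    induction h with
    | refl => exact .refl
    | tail _ h ih =>
    refine ih.tail ?_
    obtain ⟨hI, hJ, a, ha, b, hb, -, -, hab, rfl⟩ := h
    refine ⟨hI, hJ, Or.inr ⟨a, b, ?_, ?_, hab⟩⟩
    · ext x; grind
    · ext x; grind

end Slides

/-! ## Joined vertices and block graphs -/

section Joined

variable {V : Type*} {G : SimpleGraph V}

/-- There is a walk from the first vertex to the second one inside `Y`. -/
def Joined (G : SimpleGraph V) (Y : Set V) : V → V → Prop :=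
  Relation.ReflTransGen fun x y => G.Adj x y ∧ x ∈ Y ∧ y ∈ Y

lemma Joined.refl {Y : Set V} {x : V} : Joined G Y x x := Relation.ReflTransGen.refl

lemma Joined.trans {Y : Set V} {x y z : V} (h : Joined G Y x y) (h' : Joined G Y y z) :
    Joined G Y x z := Relation.ReflTransGen.trans h h'

lemma Joined.of_adj {Y : Set V} {x y : V} (h : G.Adj x y) (hx : x ∈ Y) (hy : y ∈ Y) :
    Joined G Y x y := Relation.ReflTransGen.single ⟨h, hx, hy⟩

lemma Joined.tail {Y : Set V} {x y z : V} (h : Joined G Y x y) (hyz : G.Adj y z) (hy : y ∈ Y)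
    (hz : z ∈ Y) : Joined G Y x z := h.trans (.of_adj hyz hy hz)

lemma Joined.symm {Y : Set V} {x y : V} (h : Joined G Y x y) : Joined G Y y x := by
  induction h with
  | refl => exact .refl
  | tail _ h ih => exact Relation.ReflTransGen.head ⟨h.1.symm, h.2.2, h.2.1⟩ ih

lemma Joined.mono {X Y : Set V} {x y : V} (hXY : X ⊆ Y) (h : Joined G X x y) :
    Joined G Y x y := by
  induction h with
  | refl => exact .refl
  | tail _ h ih => exact ih.tail h.1 (hXY h.2.1) (hXY h.2.2)

lemma Joined.mem {Y : Set V} {x y : V} (h : Joined G Y x y) (hx : x ∈ Y) : y ∈ Y := by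
  induction h with
  | refl => exact hx
  | tail _ h _ => exact h.2.2

/-- A walk inside `Y` that starts in a set closed under adjacency in `Y` stays in this set. -/
lemma Joined.closed {X Y : Set V} {x y : V} (h : Joined G Y x y) (hx : x ∈ X)
    (hXY : ∀ x ∈ X, ∀ y ∈ Y, G.Adj x y → y ∈ X) : Joined G (X ∩ Y) x y ∧ y ∈ X := by
  induction h with
  | refl => exact ⟨.refl, hx⟩
  | @tail a b _ h ih =>
    have hb := hXY a ih.2 b h.2.2 h.1
    exact ⟨ih.1.tail h.1 ⟨ih.2, h.2.1⟩ ⟨hb, h.2.2⟩, hb⟩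

/-- Any two neighbours of a vertex `u` that are joined in `G - u` are adjacent. This
characterizes block graphs. -/
def LocallyBlock (G : SimpleGraph V) : Prop :=
  ∀ u v y, G.Adj u v → G.Adj u y → v ≠ y → Joined G {u}ᶜ v y → G.Adj v y

end Joined

/-! ## Deleting a token from a reconfiguration -/

section Unstuck

variable {V : Type*} {G : SimpleGraph V}

lemma slideIn_insert {X M : Set V} {a b : V} (ha : G.IsIndepSet (insert a M))
    (hb : G.IsIndepSet (insert b M)) (haM : a ∉ M) (hbM : b ∉ M) (haX : a ∈ X) (hbX : b ∈ X)
    (hab : G.Adj a b) : SlideIn G X (insert a M) (insert b M) := by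
  refine ⟨ha, hb, a, by simp, b, ?_, haX, hbX, hab, ?_⟩
  · have := hab.ne'
    grind
  · ext x; grind

/-- Moves inside `Q` and inside `Y \ Q` are independent, so they can be reordered. Originally the
extra token is in `Q` at the start and outside `Q` at the end. Without it, the part outside `Q` is
moved first. This puts a token on `y`, which travels through `b` and `a` to `v`; there it plays the
part of the extra token for the moves in `Q`. -/
lemma Reach.exchange {Y Q S R : Set V} {a b v y : V}
    (h : Reach G Y (insert v S) (insert y R)) (hS : S ⊆ Y) (hR : R ⊆ Y)
    (hQ : ∀ x ∈ Q, ∀ z ∈ Y, G.Adj x z → z ∈ Q) (hQY : Q ⊆ Y) (hv : v ∈ Q) (hyY : y ∈ Y)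
    (hy : y ∉ Q) (ha : a ∉ Y) (hb : b ∉ Y) (hav : G.Adj a v) (hby : G.Adj b y)
    (hab : a = b ∨ G.Adj a b) (hvS : v ∉ S) (hyR : y ∉ R)
    (hSa : G.IsIndepSet (insert a S)) (hRb : G.IsIndepSet (insert b R))
    (hbS : ∀ x ∈ S, x ∈ Q → ¬ G.Adj b x) (haR : ∀ x ∈ R, x ∉ Q → ¬ G.Adj a x) :
    Reach G (insert a (insert b Y)) S R := by
  have hQ' : ∀ x ∈ Y \ Q, ∀ z ∈ Y, G.Adj x z → z ∈ Y \ Q := fun x hx z hz hxz =>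
    ⟨hz, fun hzQ => hx.2 (hQ z hzQ x hx.1 hxz.symm)⟩
  have hSi : G.IsIndepSet S := hSa.mono (Set.subset_insert _ _)
  have hRi : G.IsIndepSet R := hRb.mono (Set.subset_insert _ _)
  -- The tokens that stand still during the transfer: final positions outside `Q`, initial positions
  -- inside `Q`.
  set M : Set V := (R \ Q) ∪ (S ∩ Q) with hM
  have h1 : Reach G Y S (insert y M) := by
    have := h.project (X := Y \ Q) (Z := S ∩ Q) hQ' (hSi.mono Set.inter_subset_left)
      (fun x hx z hz hxz => hx.2 (hQ z hz.2 x hx.1 hxz.symm)) (fun z hz hz' => hz'.2 hz.2)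
    have e1 : insert v S ∩ (Y \ Q) ∪ S ∩ Q = S := by
      ext x; have := @hS x; grind
    have e2 : insert y R ∩ (Y \ Q) ∪ S ∩ Q = insert y M := by
      ext x; have := @hR x; grind
    rw [e1, e2] at this
    exact this.mono Set.inter_subset_right
  have h5 : Reach G Y (insert v M) R := by
    have := h.project (X := Q) (Z := R \ Q) hQ (hRi.mono Set.sdiff_subset)
      (fun x hx z hz hxz => hz.2 (hQ x hx z (hR hz.1) hxz)) (fun z hz hz' => hz.2 hz')
    have e1 : insert v S ∩ Q ∪ R \ Q = insert v M := by
      ext x; grind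
    have e2 : insert y R ∩ Q ∪ R \ Q = R := by
      ext x; grind
    rw [e1, e2] at this
    exact this.mono Set.inter_subset_right
  have hMY : M ⊆ Y := by
    rintro x (hx | hx)
    · exact hR hx.1
    · exact hS hx.1
  have hMy : G.IsIndepSet (insert y M) := h1.indep hSi
  have hMv : G.IsIndepSet (insert v M) := h5.symm.indep hRi
  have hMi : G.IsIndepSet M := hMy.mono (Set.subset_insert _ _)
  have hMb : G.IsIndepSet (insert b M) := by
    rw [indep_iff] at hMi hRb ⊢
    rintro x (rfl | hx) z (rfl | hz) hxz
    · exact hxz.ne rfl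
    · rcases hz with hz | hz
      · exact hRb x (by simp) z (by simp [hz.1]) hxz
      · exact hbS z hz.1 hz.2 hxz
    · rcases hx with hx | hx
      · exact hRb x (by simp [hx.1]) z (by simp) hxz
      · exact hbS x hx.1 hx.2 hxz.symm
    · exact hMi x hx z hz hxz
  have hMa : G.IsIndepSet (insert a M) := by
    rw [indep_iff] at hMi hSa ⊢
    rintro x (rfl | hx) z (rfl | hz) hxz
    · exact hxz.ne rfl
    · rcases hz with hz | hz
      · exact haR z hz.1 hz.2 hxz
      · exact hSa x (by simp) z (by simp [hz.1]) hxz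
    · rcases hx with hx | hx
      · exact haR x hx.1 hx.2 hxz.symm
      · exact hSa x (by simp [hx.1]) z (by simp) hxz
    · exact hMi x hx z hz hxz
  have hYX : Y ⊆ insert a (insert b Y) := fun x hx => by simp [hx]
  have hyM : y ∉ M := by grind
  have hvM : v ∉ M := by grind
  have h2 := slideIn_insert hMy hMb hyM (fun hx => hb (hMY hx)) (hYX hyY)
    (show b ∈ insert a (insert b Y) by simp) hby.symm
  have h4 := slideIn_insert hMa hMv (fun hx => ha (hMY hx)) hvM
    (show a ∈ insert a (insert b Y) by simp) (hYX (hQY hv)) hav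
  refine (h1.mono hYX).trans (h2.reach.trans (Reach.trans ?_ (h4.reach.trans (h5.mono hYX))))
  rcases hab with rfl | hab
  · exact .refl
  · exact (slideIn_insert hMb hMa (fun hx => hb (hMY hx)) (fun hx => ha (hMY hx)) (by simp)
      (by simp) hab.symm).reach

/-- In the graph `G[X]`, a token at `w` in both the first and the last configuration is not needed
for the moves of the other tokens. -/
def Deletable (G : SimpleGraph V) (X : Set V) : Prop :=
  ∀ w ∈ X, ∀ S R : Set V, S ⊆ X → R ⊆ X → w ∉ S → w ∉ R → G.IsIndepSet (insert w S) →
    Reach G X (insert w S) (insert w R) → Reach G X S R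

/-- At any time at most one token is on the clique of neighbours of `u`. The token there may be
ignored as long as the clique stays occupied. Each period with an empty clique is replaced by moves
without the ignored token: either the clique is re-entered at the vertex that was left, and `hT`
applies, or it is re-entered elsewhere, and `Reach.exchange` applies along an edge of the clique. -/
lemma Deletable.of_clique (hG : LocallyBlock G) {X S R : Set V} {u v y : V}
    (hT : Deletable G X) (hu : u ∉ X)
    (hK : ∀ x ∈ X, ∀ z ∈ X, G.Adj u x → G.Adj u z → x ≠ z → G.Adj x z)
    (hSX : S ⊆ X) (hv : v ∈ X) (hvS : v ∉ S) (hyR : y ∉ R) (huv : G.Adj u v) (huy : G.Adj u y)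
    (hS : ∀ x ∈ S, ¬ G.Adj u x) (hSv : G.IsIndepSet (insert v S))
    (h : Reach G X (insert v S) (insert y R)) : Reach G X S R := by
  have hSi : G.IsIndepSet S := hSv.mono (Set.subset_insert _ _)
  set Y : Set V := {x ∈ X | ¬ G.Adj u x} with hY
  have hYX : Y ⊆ X := fun x hx => hx.1
  -- distinct vertices of the clique have no common branch
  have hbr : ∀ w w' q q', w ∈ X → w' ∈ X → G.Adj u w → G.Adj u w' → w ≠ w' →
      q ∈ Y → G.Adj w q → Joined G Y q q' → ¬ G.Adj w' q' := by
    intro w w' q q' hw hw' huw huw' hne hq hwq hj hw'q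
    have hYw : Y ⊆ {w}ᶜ := by
      rintro x hx rfl
      exact hx.2 huw
    have hq' : q' ∈ Y := hj.mem hq
    have hqw' : q ≠ w' := by
      rintro rfl
      exact hq.2 huw'
    -- The local condition at `w` is used twice: first `q` is adjacent to `w'`, then to `u` because
    -- of the path `q`, `w'`, `u`. But `q` was chosen as a non-neighbour of `u`.
    have h1 : G.Adj q w' := by
      refine hG w q w' hwq (hK w hw w' hw' huw huw' hne) hqw' ?_
      exact (hj.mono hYw).tail hw'q.symm (hYw hq') hne.symm
    have hqu : q ≠ u := by
      rintro rfl
      exact hu hq.1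
    refine hq.2 (hG w q u hwq huw.symm hqu ?_).symm
    exact (Joined.of_adj h1 (hYw hq) hne.symm).tail huw'.symm hne.symm huw.ne
  -- While the clique is empty, the invariant remembers the last exit: a token left `w` for `v₁`,
  -- the others were at `S₁`, and all later slides avoid the clique.
  suffices key : ∀ D, Reach G X (insert v S) D →
      (∀ w ∈ D, G.Adj u w → Reach G X S (D \ {w})) ∧
      ((∀ x ∈ D, ¬ G.Adj u x) → ∃ S₁ w v₁, Reach G X S S₁ ∧ w ∈ X ∧ G.Adj u w ∧
        (∀ x ∈ S₁, ¬ G.Adj u x) ∧ G.IsIndepSet (insert w S₁) ∧ G.IsIndepSet (insert v₁ S₁) ∧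
        G.Adj w v₁ ∧ v₁ ∉ S₁ ∧ v₁ ∈ Y ∧ Reach G Y (insert v₁ S₁) D) by
    have := (key _ h).1 y (by simp) huy
    have e : insert y R \ {y} = R := by ext x; grind
    rwa [e] at this
  intro D hD
  induction hD with
  | refl =>
    refine ⟨?_, fun h => absurd huv (h v (by simp))⟩
    intro w hw huw
    have hwv : w = v := by
      rcases hw with rfl | hw
      · rfl
      · exact absurd huw (hS w hw)
    have e : insert v S \ {w} = S := by ext x; grind
    rw [e]
    exact .refl
  | @tail D D' hD hs ih =>
    have hDX : D ⊆ X := Reach.subset hD (by grind)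
    have hD'X : D' ⊆ X := hs.reach.subset hDX
    have hs' := hs
    obtain ⟨hI, hJ, a, ha, b, hb, haX, hbX, hab, hDD'⟩ := hs
    have hIi := indep_iff.1 hI
    have hJi := indep_iff.1 hJ
    constructor
    · intro w hw huw
      by_cases hDK : ∃ w' ∈ D, G.Adj u w'
      · obtain ⟨w', hw', huw'⟩ := hDK
        have hr := ih.1 w' hw' huw'
        by_cases hw'a : w' = a
        · subst hw'a
          have hwb : w = b := by
            by_contra hwb
            have hwD : w ∈ D ∧ w ≠ w' := by grind
            exact hIi w hwD.1 w' hw' (hK w (hDX hwD.1) w' haX huw huw' hwD.2)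
          have e : D' \ {w} = D \ {w'} := by ext x; grind
          rwa [e]
        · have hw'D' : w' ∈ D' := by grind
          have hww' : w = w' := by
            by_contra hne
            exact hJi w hw w' hw'D' (hK w (hD'X hw) w' (hDX hw') huw huw' hne)
          subst hww'
          refine hr.trans (SlideIn.reach ⟨hI.mono Set.sdiff_subset, hJ.mono Set.sdiff_subset, a,
            by grind, b, by grind, haX, hbX, hab, ?_⟩)
          ext x; grind
      · push Not at hDK
        obtain ⟨S₁, w₁, v₁, h1, hw1X, huw1, hS1, hi1, hi2, hwv1, hv1S, hv1Y, hr⟩ := ih.2 hDK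
        have hwb : w = b := by
          by_contra hne
          have : w ∈ D := by grind
          exact hDK w this huw
        subst hwb
        have haY : a ∈ Y := ⟨haX, hDK a ha⟩
        set R₁ := D \ {a} with hR1
        have hD1 : insert a R₁ = D := by ext x; grind
        have e : D' \ {w} = R₁ := by ext x; grind
        rw [e]
        refine h1.trans ?_
        have hS1X : S₁ ⊆ X := h1.subset hSX
        -- If the clique is re-entered at `w₁`, a token is there at both ends and `hT` deletes it.
        -- Otherwise `Q` is what hangs at `w₁`: it contains `v₁` but, by `hbr`, no neighbour of `w`,
        -- in particular not `a`.
        by_cases hww : w₁ = w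
        · subst hww
          refine hT w₁ hw1X S₁ R₁ hS1X (fun x hx => hDX hx.1) (fun hx => hS1 _ hx huw1)
            (fun hx => hb hx.1) hi1 ?_
          have t1 := slideIn_insert hi1 hi2 (fun hx => hS1 _ hx huw1) hv1S hw1X hv1Y.1 hwv1
          refine t1.reach.trans ((hr.mono hYX).trans ?_)
          rw [hDD'] at hs'
          exact hs'.reach
        · set Q : Set V := {x | ∃ q ∈ Y, G.Adj w₁ q ∧ Joined G Y q x} with hQdef
          have hQY : Q ⊆ Y := by
            rintro x ⟨q, hq, -, hj⟩
            exact hj.mem hq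
          have hQc : ∀ x ∈ Q, ∀ z ∈ Y, G.Adj x z → z ∈ Q := by
            rintro x ⟨q, hq, hwq, hj⟩ z hz hxz
            exact ⟨q, hq, hwq, hj.tail hxz (hj.mem hq) hz⟩
          have hQw : ∀ x ∈ Q, ¬ G.Adj w x := by
            rintro x ⟨q, hq, hwq, hj⟩ hx
            exact hbr w₁ w q x hw1X hbX huw1 huw hww hq hwq hj hx
          rw [← hD1] at hr
          refine (Reach.exchange (a := w₁) (b := w) hr (fun x hx => ⟨hS1X hx, hS1 x hx⟩)
            (fun x hx => ⟨hDX hx.1, hDK x hx.1⟩) hQc hQY ⟨v₁, hv1Y, hwv1, .refl⟩ haY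
            (fun haQ => hQw a haQ hab.symm) (fun hx => hx.2 huw1) (fun hx => hx.2 huw) hwv1 hab.symm
            (Or.inr (hK _ hw1X _ hbX huw1 huw hww)) hv1S (by grind) hi1 (hDD' ▸ hJ)
            (fun x _ hx => hQw x hx) ?_).mono ?_
          · intro x hx hxQ hwx
            exact hxQ ⟨x, ⟨hDX hx.1, hDK x hx.1⟩, hwx, .refl⟩
          · rintro x (rfl | rfl | hx)
            · exact hw1X
            · exact hbX
            · exact hYX hx
    · intro hK'
      have hbY : b ∈ Y := ⟨hbX, hK' b (by grind)⟩
      by_cases hDK : ∃ w ∈ D, G.Adj u w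
      · obtain ⟨w, hw, huw⟩ := hDK
        have hwa : w = a := by
          by_contra hne
          exact hK' w (by grind) huw
        subst hwa
        have e : insert w (D \ {w}) = D := by ext x; grind
        refine ⟨D \ {w}, w, b, ih.1 w hw huw, haX, huw, ?_, ?_, ?_, hab, by grind, hbY, ?_⟩
        · intro x hx
          exact hK' x (by grind)
        · rwa [e]
        · rwa [← hDD']
        · rw [hDD']; exact .refl
      · push Not at hDK
        obtain ⟨S₁, w₁, v₁, h1, hw1X, huw1, hS1, hi1, hi2, hwv1, hv1S, hv1Y, hr⟩ := ih.2 hDK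
        exact ⟨S₁, w₁, v₁, h1, hw1X, huw1, hS1, hi1, hi2, hwv1, hv1S, hv1Y,
          hr.trans (SlideIn.reach ⟨hI, hJ, a, ha, b, hb, ⟨haX, hDK a ha⟩, hbY, hab, hDD'⟩)⟩

end Unstuck

/-! ### Every set of vertices of a block graph allows the deletion of a token -/

section Deletable

variable {V : Type*} {G : SimpleGraph V}

/-- Induction on the size of `X`. Cut the sequence into periods in which `u` is occupied, where the
other tokens move without help, and excursions, which begin when a token leaves `u` for `v` and end
when some token, not necessarily the same one, enters `u` from `y`. Each excursion is imitated
without the extra token. -/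
theorem LocallyBlock.deletable [Finite V] (hG : LocallyBlock G) (X : Set V) : Deletable G X := by
  induction hn : X.ncard using Nat.strong_induction_on generalizing X with
  | _ n IH =>
  subst hn
  intro u huX S R hSX hRX huS huR hSu h
  have hXu : X \ {u} ⊆ X := Set.sdiff_subset
  -- one excursion of the token at `u`
  have excursion : ∀ S₀ v y R₀, S₀ ⊆ X → u ∉ S₀ → G.IsIndepSet (insert u S₀) →
      G.IsIndepSet (insert v S₀) → v ∉ S₀ → v ∈ X → G.Adj u v → R₀ ⊆ X → u ∉ R₀ → y ∉ R₀ →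
      G.IsIndepSet (insert u R₀) → G.Adj u y → y ∈ X →
      Reach G (X \ {u}) (insert v S₀) (insert y R₀) → Reach G X S₀ R₀ := by
    intro S₀ v y R₀ hS₀ huS₀ hiu hiv hvS₀ hvX huv hR₀ huR₀ hyR₀ hiR huy hyX hr
    set Q : Set V := {x | Joined G (X \ {u}) v x} with hQdef
    have hvY : v ∈ X \ {u} := ⟨hvX, huv.ne'⟩
    have hyY : y ∈ X \ {u} := ⟨hyX, huy.ne'⟩
    have hQY : Q ⊆ X \ {u} := fun x hx => Joined.mem hx hvY
    have hQc : ∀ x ∈ Q, ∀ z ∈ X \ {u}, G.Adj x z → z ∈ Q := fun x hx z hz hxz =>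
      Joined.tail hx hxz (hQY hx) hz
    have hSY : S₀ ⊆ X \ {u} := fun x hx => ⟨hS₀ hx, fun h => huS₀ (h ▸ hx)⟩
    have hRY : R₀ ⊆ X \ {u} := fun x hx => ⟨hR₀ hx, fun h => huR₀ (h ▸ hx)⟩
    have hiu' := indep_iff.1 hiu
    have hiR' := indep_iff.1 hiR
    have hSi : G.IsIndepSet S₀ := hiu.mono (Set.subset_insert _ _)
    have hRi : G.IsIndepSet R₀ := hiR.mono (Set.subset_insert _ _)
    -- If the token returns from another component of `X - u`, `Reach.exchange` with `a = b = u`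
    -- passes a token through `u`. If it returns from the same component `Q`, either `X - u` is
    -- connected, so that the neighbours of `u` in `X` form a clique and `Deletable.of_clique`
    -- applies in `X - u`, or the induction hypothesis handles `Q` together with `u` and the other
    -- components move on their own.
    by_cases hyQ : y ∈ Q
    · by_cases hQX : insert u Q = X
      · refine Reach.mono hXu (Deletable.of_clique hG (IH _ (Set.ncard_sdiff_singleton_lt_of_mem huX)
          _ rfl) (by simp) ?_ hSY hvY hvS₀ hyR₀ huv huy (fun x hx => hiu' u (by simp) x (by simp [hx]))
          hiv hr)
        intro x hx z hz hux huz hxz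
        have hxQ : x ∈ Q := by have := hQX.ge hx.1; grind
        have hzQ : z ∈ Q := by have := hQX.ge hz.1; grind
        exact hG u x z hux huz hxz (((Joined.symm hxQ).trans hzQ).mono fun _ h => h.2)
      · have hQX' : insert u Q ⊂ X := by
          refine lt_of_le_of_ne ?_ hQX
          rintro x (rfl | hx)
          · exact huX
          · exact (hQY hx).1
        have hT := IH _ (Set.ncard_lt_ncard hQX') _ rfl
        have h1 := hr.project (X := Q) (Z := ∅) hQc (by simp [indep_iff]) (by simp) (by simp)
        have e1 : insert v S₀ ∩ Q ∪ ∅ = insert v (S₀ ∩ Q) := by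
          have : v ∈ Q := Joined.refl
          ext x; grind
        have e2 : insert y R₀ ∩ Q ∪ ∅ = insert y (R₀ ∩ Q) := by ext x; grind
        rw [e1, e2] at h1
        have hsub1 : insert u (S₀ ∩ Q) ⊆ insert u S₀ := Set.insert_subset_insert Set.inter_subset_left
        have hsub2 : insert u (R₀ ∩ Q) ⊆ insert u R₀ := Set.insert_subset_insert Set.inter_subset_left
        have hsub3 : insert v (S₀ ∩ Q) ⊆ insert v S₀ := Set.insert_subset_insert Set.inter_subset_left
        have s1 := slideIn_insert (X := insert u Q) (hiu.mono hsub1) (hiv.mono hsub3)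
          (fun h => huS₀ h.1) (fun h => hvS₀ h.1) (by simp)
          (Set.mem_insert_of_mem _ (Joined.refl : v ∈ Q)) huv
        have s2 := slideIn_insert (X := insert u Q) (h1.indep (hiv.mono hsub3)) (hiR.mono hsub2)
          (fun h => hyR₀ h.1) (fun h => huR₀ h.1) (Set.mem_insert_of_mem _ hyQ) (by simp) huy.symm
        have h2 := hT u (by simp) (S₀ ∩ Q) (R₀ ∩ Q) (fun x hx => Set.mem_insert_of_mem _ hx.2)
          (fun x hx => Set.mem_insert_of_mem _ hx.2) (fun h => huS₀ h.1) (fun h => huR₀ h.1)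
          (hiu.mono hsub1) (s1.reach.trans ((h1.mono fun x hx => Set.mem_insert_of_mem _ hx.1).trans
            s2.reach))
        have h3 := h2.frame (Z := S₀ \ Q) (fun x hx => Set.mem_insert_of_mem _ hx.2)
          (hSi.mono Set.sdiff_subset) (by
            rintro x (rfl | hx) z hz hxz
            · exact hiu' x (by simp) z (by simp [hz.1]) hxz
            · exact hz.2 (hQc x hx z (hSY hz.1) hxz)) (by
            rintro z hz (rfl | hz')
            · exact huS₀ hz.1
            · exact hz.2 hz')
        have h4 := hr.project (X := (X \ {u}) \ Q) (Z := R₀ ∩ Q)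
          (fun x hx z hz hxz => ⟨hz, fun hzQ => hx.2 (hQc z hzQ x hx.1 hxz.symm)⟩)
          (hRi.mono Set.inter_subset_left)
          (fun x hx z hz hxz => hx.2 (hQc z hz.2 x hx.1 hxz.symm)) (fun z hz hz' => hz'.2 hz.2)
        have e3 : insert v S₀ ∩ ((X \ {u}) \ Q) ∪ R₀ ∩ Q = R₀ ∩ Q ∪ S₀ \ Q := by
          have : v ∈ Q := Joined.refl
          ext x; have := @hSY x; grind
        have e4 : insert y R₀ ∩ ((X \ {u}) \ Q) ∪ R₀ ∩ Q = R₀ := by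
          ext x; have := @hRY x; grind
        rw [Set.inter_union_sdiff] at h3
        rw [e3, e4] at h4
        exact (h3.mono hQX'.le).trans (h4.mono fun x hx => hx.1.1.1)
    · refine (Reach.exchange (a := u) (b := u) hr hSY hRY hQc hQY Joined.refl hyY hyQ (by simp)
        (by simp) huv huy (Or.inl rfl) hvS₀ hyR₀ hiu hiR
        (fun x hx _ => hiu' u (by simp) x (by simp [hx]))
        (fun x hx _ => hiR' u (by simp) x (by simp [hx]))).mono ?_
      rintro x (rfl | rfl | hx)
      · exact huX
      · exact huX
      · exact hx.1
  -- During an excursion the invariant keeps its starting point `S₀` and its first vertex `v`; it is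
  -- closed by `excursion` when `u` is occupied again.
  suffices key : ∀ D, Reach G X (insert u S) D → (u ∈ D → Reach G X S (D \ {u})) ∧
      (u ∉ D → ∃ S₀ v, Reach G X S S₀ ∧ u ∉ S₀ ∧ G.IsIndepSet (insert u S₀) ∧
        G.IsIndepSet (insert v S₀) ∧ v ∉ S₀ ∧ v ∈ X ∧ G.Adj u v ∧
        Reach G (X \ {u}) (insert v S₀) D) by
    have := (key _ h).1 (by simp)
    have e : insert u R \ {u} = R := by ext x; grind
    rwa [e] at this
  intro D hD
  induction hD with
  | refl =>
    refine ⟨fun _ => ?_, fun h => absurd (by simp) h⟩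
    have e : insert u S \ {u} = S := by ext x; grind
    rw [e]
    exact .refl
  | @tail D D' hD hs ih =>
    have hDX : D ⊆ X := Reach.subset hD (by grind)
    obtain ⟨hI, hJ, a, ha, b, hb, haX, hbX, hab, hDD'⟩ := hs
    constructor
    · intro hu'
      by_cases hu : u ∈ D
      · have hua : u ≠ a := by
          rintro rfl
          grind [hab.ne]
        refine (ih.1 hu).trans (SlideIn.reach ⟨hI.mono Set.sdiff_subset, hJ.mono Set.sdiff_subset, a,
          by grind, b, by grind, haX, hbX, hab, ?_⟩)
        ext x; grind
      · obtain ⟨S₀, v, hr, huS₀, hiu, hiv, hvS₀, hvX, huv, hr'⟩ := ih.2 hu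
        have hbu : u = b := by grind
        subst hbu
        have e : D' \ {u} = D \ {a} := by ext x; grind
        have e' : insert a (D \ {a}) = D := by ext x; grind
        rw [e]
        refine hr.trans (excursion S₀ v a (D \ {a}) (hr.subset hSX) huS₀ hiu hiv hvS₀ hvX huv
          (fun x hx => hDX hx.1) (fun hx => hu hx.1) (by simp) (hDD' ▸ hJ) hab.symm haX ?_)
        rwa [e']
    · intro hu'
      by_cases hu : u ∈ D
      · have hua : u = a := by grind
        subst hua
        have e : insert u (D \ {u}) = D := by ext x; grind
        exact ⟨D \ {u}, b, ih.1 hu, by simp, by rwa [e], by rwa [← hDD'], by grind, hbX, hab,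
          by rw [hDD']; exact .refl⟩
      · obtain ⟨S₀, v, hr, huS₀, hiu, hiv, hvS₀, hvX, huv, hr'⟩ := ih.2 hu
        refine ⟨S₀, v, hr, huS₀, hiu, hiv, hvS₀, hvX, huv, hr'.trans (SlideIn.reach
          ⟨hI, hJ, a, ha, b, hb, ⟨haX, ?_⟩, ⟨hbX, ?_⟩, hab, hDD'⟩)⟩
        · rintro rfl; exact hu ha
        · rintro rfl; exact hu' (by grind)

end Deletable

/-! ### Configurations without stuck vertices -/

section Unstuck

variable {V : Type*} {G : SimpleGraph V}

/-- The closed neighbourhood of `x`. -/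
def closedNbhd (G : SimpleGraph V) (x : V) : Set V := {z | z = x ∨ G.Adj x z}

/-- By slides in `X`, each closed neighbourhood of a vertex of `X` can be brought to contain at
most one token. -/
def Unstuck (G : SimpleGraph V) (X C : Set V) : Prop :=
  ∀ x ∈ X, ∃ C', Reach G X C C' ∧ (C' ∩ closedNbhd G x).Subsingleton

lemma Unstuck.of_reach {X C C' : Set V} (h : Unstuck G X C) (hr : Reach G X C C') :
    Unstuck G X C' := by
  intro x hx
  obtain ⟨D, hD, hs⟩ := h x hx
  exact ⟨D, hr.symm.trans hD, hs⟩

lemma exists_reach_mem_of_subsingleton {X C : Set V} {x z : V} (hC : G.IsIndepSet C) (hCX : C ⊆ X)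
    (hx : x ∈ X) (hz : z ∈ C) (hzx : z ∈ closedNbhd G x)
    (hs : (C ∩ closedNbhd G x).Subsingleton) : ∃ C', Reach G X C C' ∧ x ∈ C' := by
  rcases hzx with rfl | hxz
  · exact ⟨C, .refl, hz⟩
  by_cases hxC : x ∈ C
  · exact ⟨C, .refl, hxC⟩
  refine ⟨insert x (C \ {z}), SlideIn.reach ⟨hC, ?_, z, hz, x, hxC, hCX hz, hx, hxz.symm, rfl⟩,
    by simp⟩
  rw [indep_iff] at hC ⊢
  have h : ∀ y ∈ C \ {z}, ¬ G.Adj x y := fun y hy hxy =>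
    hy.2 (hs ⟨hy.1, Or.inr hxy⟩ ⟨hz, Or.inr hxz⟩)
  rintro p (rfl | hp) q (rfl | hq) hpq
  · exact hpq.ne rfl
  · exact h q hq hpq
  · exact h p hp hpq.symm
  · exact hC p hp.1 q hq.1 hpq

/-- The closed neighbourhood of `x` is occupied at the start. While it holds two tokens, one slide
cannot empty it; once it holds exactly one, that token can go to `x`. So if `x` could never be
occupied, the neighbourhood would never become empty, and its single token in `C'` could slide to
`x` after all. -/
lemma exists_reach_mem_of_adj {X C C' : Set V} {x t : V} (hC : G.IsIndepSet C) (hCX : C ⊆ X)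
    (hx : x ∈ X) (ht : t ∈ C) (hxt : G.Adj x t) (h : Reach G X C C')
    (hs : (C' ∩ closedNbhd G x).Subsingleton) : ∃ D, Reach G X C D ∧ x ∈ D := by
  by_contra! hno
  suffices key : ∀ D, Reach G X C D → (D ∩ closedNbhd G x).Nonempty by
    obtain ⟨z, hz, hzx⟩ := key C' h
    obtain ⟨D, hD, hxD⟩ := exists_reach_mem_of_subsingleton (h.indep hC) (h.subset hCX) hx hz hzx hs
    exact hno D (h.trans hD) hxD
  intro D hD
  induction hD with
  | refl => exact ⟨t, ht, Or.inr hxt⟩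
  | @tail D D' hD hs ih =>
    obtain ⟨z, hz, hzx⟩ := ih
    by_cases hsub : (D ∩ closedNbhd G x).Subsingleton
    · obtain ⟨E, hE, hxE⟩ := exists_reach_mem_of_subsingleton (Reach.indep hD hC)
        (Reach.subset hD hCX) hx hz hzx hsub
      exact absurd hxE (hno E (Reach.trans hD hE))
    · obtain ⟨p, hp, q, hq, hpq⟩ := Set.not_subsingleton_iff.1 hsub
      obtain ⟨hI, hJ, a, ha, b, hb, haX, hbX, hab, rfl⟩ := hs
      by_cases hpa : p = a
      · exact ⟨q, by grind, hq.2⟩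
      · exact ⟨p, by grind, hp.2⟩

/-- In a connected graph without stuck vertices, a token can be brought to any vertex. -/
lemma Unstuck.exists_reach_mem {X C : Set V} (h : Unstuck G X C) (hC : G.IsIndepSet C)
    (hCX : C ⊆ X) (hne : C.Nonempty) (hX : ∀ x ∈ X, ∀ y ∈ X, Joined G X x y) {b : V}
    (hb : b ∈ X) : ∃ D, Reach G X C D ∧ b ∈ D := by
  obtain ⟨t, ht⟩ := hne
  have := hX t (hCX ht) b hb
  induction this with
  | refl => exact ⟨C, .refl, ht⟩
  | @tail x y _ hxy ih =>
    obtain ⟨D, hD, hxD⟩ := ih hxy.2.1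
    obtain ⟨D', hD', hs⟩ := (h.of_reach hD) y hxy.2.2
    obtain ⟨E, hE, hyE⟩ := exists_reach_mem_of_adj (hD.indep hC) (hD.subset hCX) hxy.2.2 hxD
      hxy.1.symm hD' hs
    exact ⟨E, hD.trans hE, hyE⟩

/-- In a connected block graph with at least two vertices, there is a vertex `u` such that all but
one of the blocks that contain `u` are leaf blocks; `A` consists of the other vertices of these
leaf blocks. -/
lemma LocallyBlock.exists_leaf_blocks [Finite V] (hG : LocallyBlock G) {X : Set V}
    (hX : ∀ x ∈ X, ∀ y ∈ X, Joined G X x y) (hX2 : X.Nontrivial) :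
    ∃ u ∈ X, ∃ A ⊆ X, u ∉ A ∧ A.Nonempty ∧ (∀ y ∈ A, G.Adj u y) ∧
      (∀ y ∈ A, ∀ z ∈ X, z ≠ u → G.Adj y z → z ∈ A) ∧
      (∀ x ∈ X \ insert u A, ∀ y ∈ X \ insert u A, Joined G (X \ insert u A) x y) := by
  -- Induction on the size of `A`, where `A` is closed under adjacency in `X - u` and the remainder
  -- is connected. The start is any `u` with all other vertices in `A`, so that the remainder is
  -- empty.
  suffices key : ∀ n, ∀ u ∈ X, ∀ A ⊆ X, u ∉ A → A.Nonempty →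
      (∀ y ∈ A, ∀ z ∈ X, z ≠ u → G.Adj y z → z ∈ A) →
      (∀ x ∈ X \ insert u A, ∀ y ∈ X \ insert u A, Joined G (X \ insert u A) x y) → A.ncard = n →
      ∃ u ∈ X, ∃ A ⊆ X, u ∉ A ∧ A.Nonempty ∧ (∀ y ∈ A, G.Adj u y) ∧
      (∀ y ∈ A, ∀ z ∈ X, z ≠ u → G.Adj y z → z ∈ A) ∧
      (∀ x ∈ X \ insert u A, ∀ y ∈ X \ insert u A, Joined G (X \ insert u A) x y) by
    obtain ⟨u, hu, z, hz, huz⟩ := hX2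
    refine key _ u hu (X \ {u}) Set.sdiff_subset (by simp) ⟨z, hz, huz.symm⟩
      (fun y _ z hz hzu _ => ⟨hz, hzu⟩) ?_ rfl
    intro x hx
    exact absurd hx.1 (by grind)
  intro n
  induction n using Nat.strong_induction_on with
  | _ n IH =>
  intro u hu A hAX huA hne hcl hconn hn
  -- If some `w` in `A` separates `u` from other vertices of `X`, these lie in `A` and form a
  -- smaller set for `w`. If there is no such `w`, adjacency to `u` spreads along every walk from
  -- `u` into `A`: when `p` is adjacent to `u` and to `q`, the vertices `u` and `q` are joined
  -- around `p`.
  by_cases hw : ∃ w ∈ A, ∃ x ∈ X, x ≠ w ∧ ¬ Joined G (X \ {w}) u x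
  · obtain ⟨w, hwA, x₀, hx₀, hx₀w, hnj⟩ := hw
    have huw : u ≠ w := by
      rintro rfl
      exact huA hwA
    have huY : u ∈ X \ {w} := ⟨hu, huw⟩
    set A' : Set V := {x | x ∈ X ∧ x ≠ w ∧ ¬ Joined G (X \ {w}) u x} with hA'
    have hA'A : A' ⊆ A := by
      rintro x ⟨hxX, hxw, hxj⟩
      by_contra hxA
      refine hxj ?_
      have hxu : x ≠ u := by
        rintro rfl
        exact hxj .refl
      have hxT : x ∈ X \ insert u A := ⟨hxX, by simp [hxu, hxA]⟩
      have hTY : X \ insert u A ⊆ X \ {w} := by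
        rintro t ht
        exact ⟨ht.1, by rintro rfl; exact ht.2 (by simp [hwA])⟩
      have hadj : ∃ t ∈ X \ insert u A, G.Adj u t := by
        by_contra! hno
        have := ((hX x hxX u hu).closed (X := X \ insert u A) hxT ?_).2
        · exact this.2 (by simp)
        · intro p hp q hq hpq
          refine ⟨hq, ?_⟩
          rintro (rfl | hqA)
          · exact hno p hp hpq.symm
          · exact hp.2 (Or.inr (hcl q hqA p hp.1 (fun h => hp.2 (by simp [h])) hpq.symm))
      obtain ⟨t, ht, hut⟩ := hadj
      exact (Joined.of_adj hut huY (hTY ht)).trans ((hconn t ht x hxT).mono hTY)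
    have hlt : A'.ncard < n := by
      rw [← hn]
      exact Set.ncard_lt_ncard ((Set.ssubset_iff_of_subset hA'A).2 ⟨w, hwA, fun h => h.2.1 rfl⟩)
    refine IH _ hlt w (hAX hwA) A' (fun x hx => hx.1) (fun h => h.2.1 rfl) ⟨x₀, hx₀, hx₀w, hnj⟩ ?_ ?_
      rfl
    · intro y hy z hz hzw hyz
      exact ⟨hz, hzw, fun hj => hy.2.2 (hj.tail hyz.symm ⟨hz, hzw⟩ ⟨hy.1, hy.2.1⟩)⟩
    · have hR : ∀ x ∈ X \ insert w A', Joined G (X \ insert w A') u x := by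
        intro x hx
        have hxw : x ≠ w := fun h => hx.2 (by simp [h])
        have hj : Joined G (X \ {w}) u x := by
          by_contra hj
          exact hx.2 (Or.inr ⟨hx.1, hxw, hj⟩)
        refine (hj.closed (X := {x | Joined G (X \ {w}) u x}) .refl
          (fun p hp q hq hpq => Joined.tail hp hpq (hp.mem huY) hq)).1.mono ?_
        rintro p ⟨hp, hp'⟩
        refine ⟨hp'.1, ?_⟩
        rintro (rfl | hpA)
        · exact hp'.2 rfl
        · exact hpA.2.2 hp
      intro x hx y hy
      exact (hR x hx).symm.trans (hR y hy)
  · push Not at hw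
    refine ⟨u, hu, A, hAX, huA, hne, ?_, hcl, hconn⟩
    intro y hy
    have : ∀ z, Joined G X u z → z ∈ A → G.Adj u z := by
      intro z hz
      induction hz with
      | refl => exact fun h => absurd h huA
      | @tail p q _ hpq ih =>
        intro hqA
        by_cases hpu : p = u
        · exact hpu ▸ hpq.1
        · have hpA := hcl q hqA p hpq.2.1 hpu hpq.1.symm
          have hqu : q ≠ u := fun h => huA (h ▸ hqA)
          refine hG p u q (ih hpA).symm hpq.1 hqu.symm ?_
          exact (hw p hpA q hpq.2.2 hpq.1.ne').mono fun x hx => hx.2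
    exact this y (hX u hu y (hAX hy)) hy

/-- Removing a token in the leaf blocks at `u` does not create stuck vertices. -/
lemma Unstuck.remove_leaf_blocks [Finite V] (hG : LocallyBlock G) {X A C : Set V} {u b : V}
    (huX : u ∈ X) (huA : u ∉ A) (hadj : ∀ y ∈ A, G.Adj u y)
    (hcl : ∀ y ∈ A, ∀ z ∈ X, z ≠ u → G.Adj y z → z ∈ A)
    (hconn : ∀ x ∈ X \ insert u A, ∀ y ∈ X \ insert u A, Joined G (X \ insert u A) x y)
    (hC : G.IsIndepSet C) (hCX : C ⊆ X) (hb : b ∈ A) (hbC : b ∈ C) (h : Unstuck G X C) :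
    (∀ x ∈ C, x ∈ insert u A → x = b) ∧ Unstuck G (X \ insert u A) (C \ insert u A) := by
  -- Two tokens in `A` block `u` forever and therefore never leave `A`, so the neighbourhood of `u`
  -- could not be thinned out to one token.
  have hone : ∀ D, Reach G X C D → ∀ x ∈ D, ∀ y ∈ D, x ∈ insert u A → y ∈ insert u A → x = y := by
    intro D hD
    by_contra! hno
    obtain ⟨x, hx, y, hy, hxL, hyL, hxy⟩ := hno
    have hDi := indep_iff.1 (hD.indep hC)
    have hxA : x ∈ A ∧ y ∈ A := by
      rcases hxL with rfl | hxA <;> rcases hyL with rfl | hyA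
      · exact absurd rfl hxy
      · exact absurd (hadj y hyA) (hDi _ hx _ hy)
      · exact absurd (hadj x hxA) (hDi _ hy _ hx)
      · exact ⟨hxA, hyA⟩
    have key : ∀ E, Reach G X D E → ∃ x ∈ E, ∃ y ∈ E, x ∈ A ∧ y ∈ A ∧ x ≠ y := by
      intro E hE
      induction hE with
      | refl => exact ⟨x, hx, y, hy, hxA.1, hxA.2, hxy⟩
      | @tail E E' _ hs ih =>
        obtain ⟨p, hp, q, hq, hpA, hqA, hpq⟩ := ih
        obtain ⟨hI, hJ, s, hs, t, ht, hsX, htX, hst, rfl⟩ := hs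
        have hJ := indep_iff.1 hJ
        have move : ∀ p ∈ E, ∀ q ∈ E, p ∈ A → q ∈ A → p ≠ q → s = p → t ∈ A := by
          rintro p hp q hq hpA hqA hpq rfl
          refine hcl s hpA t htX ?_ hst
          rintro rfl
          exact hJ t (by simp) q (by grind) (hadj q hqA)
        by_cases hsp : s = p
        · exact ⟨t, by simp, q, by grind, move p hp q hq hpA hqA hpq hsp, hqA, by grind⟩
        · by_cases hsq : s = q
          · exact ⟨p, by grind, t, by simp, hpA, move q hq p hp hqA hpA hpq.symm hsq, by grind⟩
          · exact ⟨p, by grind, q, by grind, hpA, hqA, hpq⟩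
    obtain ⟨E, hE, hs⟩ := (h.of_reach hD) u huX
    obtain ⟨x, hx, y, hy, hxA, hyA, hxy⟩ := key E hE
    exact hxy (hs ⟨hx, Or.inr (hadj x hxA)⟩ ⟨hy, Or.inr (hadj y hyA)⟩)
  refine ⟨fun x hx hxL => hone C .refl x hx b hbC hxL (Or.inr hb), ?_⟩
  set L := insert u A with hL
  have hLb : ∀ y ∈ L, y ≠ u → ∀ z ∈ X, G.Adj y z → z ∈ L := by
    intro y hy hyu z hz hyz
    by_cases hzu : z = u
    · exact Or.inl hzu
    · exact Or.inr (hcl y (hy.resolve_left hyu) z hz hzu hyz)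
  have hAL : ∀ y ∈ L, y ≠ u → G.Adj u y := fun y hy hyu => hadj y (hy.resolve_left hyu)
  have huL : u ∈ L := by simp [hL]
  have hK : ∀ x ∈ X \ L, ∀ z ∈ X \ L, G.Adj u x → G.Adj u z → x ≠ z → G.Adj x z := by
    intro x hx z hz hux huz hxz
    refine hG u x z hux huz hxz ((hconn x hx z hz).mono ?_)
    rintro p hp rfl
    exact hp.2 huL
  -- The tokens outside `L` move on their own while a token is in `L`. Only `u` connects `L` with
  -- the rest, so the token leaves `L` and a token enters it through `u`. The part between leaving
  -- and entering is imitated without that token by `Deletable.of_clique`.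
  have key : ∀ D, Reach G X C D →
      ((∃ x ∈ D, x ∈ L) → Reach G (X \ L) (C \ L) (D \ L)) ∧
      ((∀ x ∈ D, x ∉ L) → ∃ S v, Reach G (X \ L) (C \ L) S ∧ (∀ x ∈ S, ¬ G.Adj u x) ∧
        v ∈ X \ L ∧ G.Adj u v ∧ v ∉ S ∧ G.IsIndepSet (insert v S) ∧
        Reach G (X \ L) (insert v S) D) := by
    intro D hD
    induction hD with
    | refl => exact ⟨fun _ => .refl, fun hno => absurd (Or.inr hb) (hno b hbC)⟩
    | @tail D D' hD hs ih =>
      have hDX : D ⊆ X := Reach.subset hD hCX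
      have hone1 := hone D hD
      have hone2 := hone D' (Reach.trans hD hs.reach)
      obtain ⟨hI, hJ, a, ha, c, hc, haX, hcX, hac, hDD'⟩ := hs
      have hIi := indep_iff.1 hI
      have hJi := indep_iff.1 hJ
      have hcD' : c ∈ D' := by grind
      have haD' : a ∉ D' := by have := hac.ne; grind
      constructor
      · rintro ⟨x, hx, hxL⟩
        by_cases hDL : ∃ x ∈ D, x ∈ L
        · refine (ih.1 hDL).trans ?_
          obtain ⟨y, hy, hyL⟩ := hDL
          by_cases haL : a ∈ L
          · have hcL : c ∈ L := by
              by_contra hcL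
              have hxD : x ∈ D := by grind
              have : x = a := hone1 x hxD a ha hxL haL
              exact haD' (this ▸ hx)
            have e : D' \ L = D \ L := by ext x; grind
            rw [e]
            exact .refl
          · have hcL : c ∉ L := by
              intro hcL
              have hyD' : y ∈ D' := by grind
              have : y = c := hone2 y hyD' c hcD' hyL hcL
              exact hc (this ▸ hy)
            refine SlideIn.reach ⟨hI.mono Set.sdiff_subset, hJ.mono Set.sdiff_subset, a, ⟨ha, haL⟩,
              c, fun h => hc h.1, ⟨haX, haL⟩, ⟨hcX, hcL⟩, hac, ?_⟩
            ext x; grind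
        · push Not at hDL
          obtain ⟨S, v, hr, hS, hv, huv, hvS, hSv, hr'⟩ := ih.2 hDL
          have hxc : x = c := by
            by_contra hne
            exact hDL x (by grind) hxL
          subst hxc
          have hxu : x = u := by
            by_contra hxu
            exact hDL a ha (hLb x hxL hxu a haX hac.symm)
          subst hxu
          have e : D' \ L = D \ {a} := by
            ext z; have := hDL z; grind
          have e' : insert a (D \ {a}) = D := by ext x; grind
          rw [e]
          refine hr.trans (Deletable.of_clique (u := x) (v := v) (y := a) hG (hG.deletable _)
            (fun h => h.2 huL) hK (hr.subset (fun z hz => ⟨hCX hz.1, hz.2⟩)) hv hvS (by simp) huv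
            hac.symm hS hSv (by rwa [e']))
      · intro hno
        by_cases hDL : ∃ x ∈ D, x ∈ L
        · obtain ⟨y, hy, hyL⟩ := hDL
          have hya : y = a := by
            by_contra hne
            exact hno y (by grind) hyL
          subst hya
          have hyu : y = u := by
            by_contra hyu
            exact hno c hcD' (hLb y hyL hyu c hcX hac)
          subst hyu
          have e : D \ L = D \ {y} := by
            ext z
            have := hone1 z
            grind
          have hr := ih.1 ⟨y, hy, hyL⟩
          rw [e] at hr
          refine ⟨D \ {y}, c, hr, fun x hx => hIi y hy x hx.1, ⟨hcX, hno c hcD'⟩, hac, by grind,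
            hDD' ▸ hJ, ?_⟩
          rw [hDD']
          exact .refl
        · push Not at hDL
          obtain ⟨S, v, hr, hS, hv, huv, hvS, hSv, hr'⟩ := ih.2 hDL
          exact ⟨S, v, hr, hS, hv, huv, hvS, hSv, hr'.trans (SlideIn.reach
            ⟨hI, hJ, a, ha, c, hc, ⟨haX, hDL a ha⟩, ⟨hcX, hno c hcD'⟩, hac, hDD'⟩)⟩
  intro x hx
  obtain ⟨D, hD, hs⟩ := h x hx.1
  by_cases hDL : ∃ y ∈ D, y ∈ L
  · exact ⟨D \ L, (key D hD).1 hDL, hs.anti (Set.inter_subset_inter_left _ Set.sdiff_subset)⟩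
  · push Not at hDL
    obtain ⟨S, v, hr, hS, hv, huv, hvS, hSv, hr'⟩ := (key D hD).2 hDL
    -- Here the token of `L` is still outside at the end. Following it and leaving it out only
    -- deletes tokens from the neighbourhood of `x`.
    obtain ⟨z, hz, hr''⟩ := hr'.remove hvS
    exact ⟨D \ {z}, hr.trans hr'',
      hs.anti (Set.inter_subset_inter_left _ Set.sdiff_subset)⟩

/-- In a connected block graph, any two independent sets of the same size without stuck vertices
are reachable from each other. -/
theorem Unstuck.reach [Finite V] (hG : LocallyBlock G) {X C D : Set V}
    (hX : ∀ x ∈ X, ∀ y ∈ X, Joined G X x y) (hC : G.IsIndepSet C) (hD : G.IsIndepSet D)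
    (hCX : C ⊆ X) (hDX : D ⊆ X) (hcard : C.ncard = D.ncard) (huC : Unstuck G X C)
    (huD : Unstuck G X D) : Reach G X C D := by
  induction hn : X.ncard using Nat.strong_induction_on generalizing X C D with
  | _ n IH =>
  subst hn
  rcases C.eq_empty_or_nonempty with rfl | hCne
  · have : D = ∅ := (Set.ncard_eq_zero).1 (by rw [← hcard, Set.ncard_empty])
    rw [this]
    exact .refl
  have hDne : D.Nonempty := by
    rw [← Set.ncard_pos, ← hcard, Set.ncard_pos]
    exact hCne
  by_cases hX2 : X.Nontrivial
  · obtain ⟨u, hu, A, hAX, huA, ⟨b, hb⟩, hadj, hcl, hconn⟩ := hG.exists_leaf_blocks hX hX2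
    -- Both configurations get a token on the same `b` in the leaf blocks. It is then the only token
    -- that is cut off, and as `b` has no neighbour in the remainder, it can be put back after the
    -- induction.
    obtain ⟨C', hCC', hbC⟩ := huC.exists_reach_mem hC hCX hCne hX (hAX hb)
    obtain ⟨D', hDD', hbD⟩ := huD.exists_reach_mem hD hDX hDne hX (hAX hb)
    have hC' := hCC'.indep hC
    have hD' := hDD'.indep hD
    have hCX' := hCC'.subset hCX
    have hDX' := hDD'.subset hDX
    obtain ⟨hCL, hCu⟩ := (huC.of_reach hCC').remove_leaf_blocks hG hu huA hadj hcl hconn hC' hCX'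
      hb hbC
    obtain ⟨hDL, hDu⟩ := (huD.of_reach hDD').remove_leaf_blocks hG hu huA hadj hcl hconn hD' hDX'
      hb hbD
    have eC : C' \ insert u A = C' \ {b} := by ext z; have := hCL z; grind
    have eD : D' \ insert u A = D' \ {b} := by ext z; have := hDL z; grind
    have hcard' : (C' \ insert u A).ncard = (D' \ insert u A).ncard := by
      rw [eC, eD, Set.ncard_sdiff_singleton_of_mem hbC, Set.ncard_sdiff_singleton_of_mem hbD,
        ← hCC'.ncard_eq, ← hDD'.ncard_eq, hcard]
    have hlt : (X \ insert u A).ncard < X.ncard :=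
      Set.ncard_lt_ncard ((Set.ssubset_iff_of_subset Set.sdiff_subset).2 ⟨u, hu, fun h => h.2 (by simp)⟩)
    have hr := IH _ hlt hconn (hC'.mono Set.sdiff_subset) (hD'.mono Set.sdiff_subset)
      (Set.sdiff_subset_sdiff_left hCX') (Set.sdiff_subset_sdiff_left hDX') hcard' hCu hDu rfl
    have hr' := hr.frame (Z := {b}) (Set.sdiff_subset_sdiff_left hCX') (by simp [indep_iff])
      (by
        rintro x hx z rfl hxz
        refine hx.2 (Or.inr (hcl z hb x hx.1 ?_ hxz.symm))
        rintro rfl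
        exact hx.2 (by simp))
      (by
        rintro z rfl hz
        exact hz.2 (Or.inr hb))
    rw [eC, eD, Set.sdiff_union_of_subset (by simpa using hbC),
      Set.sdiff_union_of_subset (by simpa using hbD)] at hr'
    exact hCC'.trans ((hr'.mono Set.sdiff_subset).trans hDD'.symm)
  · rw [Set.not_nontrivial_iff] at hX2
    have e : C = D := by
      obtain ⟨c, hc⟩ := hCne
      obtain ⟨d, hd⟩ := hDne
      ext z
      constructor
      · intro hz
        rwa [hX2 (hCX hz) (hDX hd)]
      · intro hz
        rwa [hX2 (hDX hz) (hCX hc)]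
    rw [e]
    exact .refl

end Unstuck

/-! ## Blocks and cut-vertices of block graphs -/

section Blocks

variable {V : Type*} {G : SimpleGraph V}

lemma Joined.of_walk {Y : Set V} {x y : V} (p : G.Walk x y) (hp : ∀ z ∈ p.support, z ∈ Y) :
    Joined G Y x y := by
  induction p with
  | nil => exact .refl
  | cons h p ih =>
    refine (Joined.of_adj h (hp _ (by simp)) (hp _ (by simp))).trans (ih fun z hz => hp z ?_)
    simp [hz]

lemma Joined.exists_walk {Y : Set V} {x y : V} (h : Joined G Y x y) (hx : x ∈ Y) :
    ∃ p : G.Walk x y, ∀ z ∈ p.support, z ∈ Y := by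
  induction h with
  | refl => exact ⟨.nil, by simpa using hx⟩
  | tail _ h ih =>
    obtain ⟨p, hp⟩ := ih
    refine ⟨p.concat h.1, fun z hz => ?_⟩
    rw [SimpleGraph.Walk.support_concat] at hz
    simp only [List.mem_append, List.mem_singleton] at hz
    rcases hz with hz | rfl
    · exact hp z hz
    · exact h.2.2

lemma preconnected_induce_iff_joined {S : Set V} :
    (G.induce S).Preconnected ↔ ∀ x ∈ S, ∀ y ∈ S, Joined G S x y := by
  rw [preconnected_induce_iff_walk]
  constructor
  · intro h x hx y hy
    obtain ⟨p, hp⟩ := h x hx y hy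
    exact .of_walk p hp
  · intro h x hx y hy
    exact (h x hx y hy).exists_walk hx

lemma reachable_induce_iff_joined {S : Set V} {a b : S} :
    (G.induce S).Reachable a b ↔ Joined G S a.1 b.1 := by
  constructor
  · rintro ⟨p⟩
    induction p with
    | nil => exact .refl
    | @cons a' b' c' h p ih => exact (Joined.of_adj (SimpleGraph.induce_adj.1 h) a'.2 b'.2).trans ih
  · intro h
    obtain ⟨p, hp⟩ := h.exists_walk a.2
    exact ⟨p.induce S hp⟩

/-- The neighbours of a vertex in a block graph satisfy `LocallyBlock`: a cycle lies in a block. -/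
theorem IsBlockGraph.locallyBlock [Finite V] (hG : IsBlockGraph G) : LocallyBlock G := by
  classical
  intro u v y huv huy hvy hj
  obtain ⟨p', hp'⟩ := hj.exists_walk huv.ne'
  set p := p'.bypass with hpdef
  have hpp : p.IsPath := p'.bypass_isPath
  have hp : u ∉ p.support := fun h => hp' u (p'.support_bypass_subset_support h) rfl
  -- A path from `v` to `y` that avoids `u` closes up to a cycle through `u`. The cycle is
  -- 2-connected, hence contained in a block, which is a clique.
  set S : Set V := insert u {x | x ∈ p.support} with hS
  have huS : u ∈ S := by simp [hS]
  have hpS : ∀ z ∈ p.support, z ∈ S := fun z hz => Or.inr hz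
  have hjoin : ∀ x z, z ∈ p.support → z ≠ x → x ≠ u → Joined G (S \ {x}) z u := by
    intro x z hz hzx hxu
    by_cases hx : x ∈ (p.takeUntil z hz).support
    · have hx2 : x ∉ (p.dropUntil z hz).support := by
        intro hx2
        have hap : ((p.takeUntil z hz).append (p.dropUntil z hz)).IsPath := by
          rw [SimpleGraph.Walk.take_spec]; exact hpp
        have hnd := hap.support_nodup
        rw [SimpleGraph.Walk.support_append] at hnd
        rw [SimpleGraph.Walk.mem_support_iff] at hx2
        exact (List.disjoint_of_nodup_append hnd) hx (hx2.resolve_left (Ne.symm hzx))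
      have h1 : ∀ w ∈ (p.dropUntil z hz).support, w ∈ S \ {x} := fun w hw =>
        ⟨hpS w (p.support_dropUntil_subset_support hz hw), by rintro rfl; exact hx2 hw⟩
      exact (Joined.of_walk _ h1).tail huy.symm (h1 _ (SimpleGraph.Walk.end_mem_support _))
        ⟨huS, hxu.symm⟩
    · have h1 : ∀ w ∈ (p.takeUntil z hz).support, w ∈ S \ {x} := fun w hw =>
        ⟨hpS w (p.support_takeUntil_subset_support hz hw), by rintro rfl; exact hx hw⟩
      exact (Joined.of_walk _ h1).symm.tail huv.symm (h1 _ (SimpleGraph.Walk.start_mem_support _))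
        ⟨huS, hxu.symm⟩
  have hv : ∀ z ∈ p.support, Joined G (S \ {u}) v z := fun z hz =>
    .of_walk (p.takeUntil z hz) fun w hw =>
      ⟨hpS w (p.support_takeUntil_subset_support hz hw), by
        rintro rfl; exact hp (p.support_takeUntil_subset_support hz hw)⟩
  have hpre : ∀ x, (G.induce (S \ {x})).Preconnected := by
    intro x
    rw [preconnected_induce_iff_joined]
    by_cases hxu : x = u
    · subst hxu
      rintro a ⟨ha, hax⟩ b ⟨hb, hbx⟩
      exact (hv a (ha.resolve_left hax)).symm.trans (hv b (hb.resolve_left hbx))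
    · have hu : ∀ a ∈ S \ {x}, Joined G (S \ {x}) a u := by
        rintro a ⟨rfl | ha, hax⟩
        · exact .refl
        · exact hjoin x a ha hax hxu
      intro a ha b hb
      exact (hu a ha).trans (hu b hb).symm
  have hconn : (G.induce S).Connected := by
    have : Nonempty S := ⟨⟨u, huS⟩⟩
    refine SimpleGraph.Connected.mk (preconnected_induce_iff_joined.2 ?_)
    have hu : ∀ a ∈ S, Joined G S v a := by
      rintro a (rfl | ha)
      · exact .of_adj huv.symm (hpS v (SimpleGraph.Walk.start_mem_support _)) huS
      · exact (hv a ha).mono Set.sdiff_subset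
    intro a ha b hb
    exact (hu a ha).symm.trans (hu b hb)
  have hS2 : IsTwoConnected G S :=
    ⟨hconn, Set.eq_empty_iff_forall_notMem.2 fun x => notMem_cutVertices (hpre x)⟩
  obtain ⟨B, hSB, hB⟩ := (Set.toFinite {T : Set V | T ⊆ Set.univ ∧ IsTwoConnected G T}).exists_le_maximal
    (show S ∈ {T : Set V | T ⊆ Set.univ ∧ IsTwoConnected G T} from ⟨Set.subset_univ _, hS2⟩)
  exact hG B hB (hSB (hpS v (SimpleGraph.Walk.start_mem_support _)))
    (hSB (hpS y (SimpleGraph.Walk.end_mem_support _))) hvy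

/-- A walk through `x` can be rerouted around `x` unless two neighbours of `x` are separated. The
second clause carries the induction over the moments when the walk is at `x` itself. -/
lemma joined_sdiff_or {S : Set V} {x p z : V} (hp : p ∈ S \ {x}) (h : Joined G S p z) :
    (z ≠ x → Joined G (S \ {x}) p z ∨ ∃ a ∈ S, ∃ b ∈ S, G.Adj x a ∧ G.Adj x b ∧
      ¬ Joined G (S \ {x}) a b) ∧
    (z = x → ∃ a ∈ S, G.Adj x a ∧ (Joined G (S \ {x}) p a ∨ ∃ a ∈ S, ∃ b ∈ S, G.Adj x a ∧
      G.Adj x b ∧ ¬ Joined G (S \ {x}) a b)) := by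
  induction h with
  | refl => exact ⟨fun _ => Or.inl .refl, fun h => absurd h hp.2⟩
  | @tail y z _ hyz ih =>
    obtain ⟨hadj, hy, hz⟩ := hyz
    constructor
    · intro hzx
      by_cases hyx : y = x
      · subst hyx
        obtain ⟨a, ha, hya, hj | hex⟩ := ih.2 rfl
        · by_cases haz : Joined G (S \ {y}) a z
          · exact Or.inl (hj.trans haz)
          · exact Or.inr ⟨a, ha, z, hz, hya, hadj, haz⟩
        · exact Or.inr hex
      · exact (ih.1 hyx).imp_left fun hj => hj.tail hadj ⟨hy, hyx⟩ ⟨hz, hzx⟩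
    · rintro rfl
      exact ⟨y, hy, hadj.symm, ih.1 hadj.ne⟩

/-- The cut-vertices of `G[S]` are the vertices with two neighbours in different components
of `G[S] - x`. -/
lemma mem_cutVertices_iff_joined [Finite V] {S : Set V} {x : V} :
    x ∈ cutVertices G S ↔ x ∈ S ∧ ∃ a ∈ S, ∃ b ∈ S, G.Adj x a ∧ G.Adj x b ∧
      ¬ Joined G (S \ {x}) a b := by
  -- If no two neighbours of `x` in `S` are separated, `f` is injective and the number of components
  -- does not grow. If two are, `f` is surjective but not injective: a neighbour represents the
  -- component of `x`, and `x` merges two components.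
  let f : (G.induce (S \ {x})).ConnectedComponent → (G.induce S).ConnectedComponent :=
    SimpleGraph.ConnectedComponent.map
      (SimpleGraph.induceHomOfLE G (Set.sdiff_subset : S \ {x} ⊆ S)).toHom
  constructor
  · rintro ⟨hx, hlt⟩
    refine ⟨hx, ?_⟩
    by_contra hno
    have hinj : Function.Injective f := by
      intro c d
      induction c using SimpleGraph.ConnectedComponent.ind with | _ p
      induction d using SimpleGraph.ConnectedComponent.ind with | _ q
      intro h
      have h := SimpleGraph.ConnectedComponent.eq.1 h
      rw [reachable_induce_iff_joined] at h
      refine SimpleGraph.ConnectedComponent.eq.2 (reachable_induce_iff_joined.2 ?_)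
      exact ((joined_sdiff_or p.2 h).1 q.2.2).resolve_right hno
    exact absurd hlt (not_lt.2 (Nat.card_le_card_of_injective f hinj))
  · rintro ⟨hx, a, ha, b, hb, hxa, hxb, hj⟩
    have := Fintype.ofFinite (G.induce (S \ {x})).ConnectedComponent
    have := Fintype.ofFinite (G.induce S).ConnectedComponent
    refine ⟨hx, ?_⟩
    rw [numComponents, numComponents, Nat.card_eq_fintype_card, Nat.card_eq_fintype_card]
    refine Fintype.card_lt_of_surjective_not_injective f ?_ ?_
    · intro c
      induction c using SimpleGraph.ConnectedComponent.ind with | _ p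
      by_cases hpx : p.1 = x
      · refine ⟨SimpleGraph.connectedComponentMk _ ⟨a, ha, hxa.ne'⟩,
          SimpleGraph.ConnectedComponent.eq.2 (reachable_induce_iff_joined.2 ?_)⟩
        exact .of_adj (hpx ▸ hxa.symm) ha p.2
      · exact ⟨SimpleGraph.connectedComponentMk _ ⟨p.1, p.2, hpx⟩, rfl⟩
    · intro hinj
      refine hj (reachable_induce_iff_joined.1 (SimpleGraph.ConnectedComponent.eq.1
        (@hinj (SimpleGraph.connectedComponentMk _ ⟨a, ha, hxa.ne'⟩)
          (SimpleGraph.connectedComponentMk _ ⟨b, hb, hxb.ne'⟩)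
          (SimpleGraph.ConnectedComponent.eq.2 (reachable_induce_iff_joined.2 ?_)))))
      exact (Joined.of_adj hxa.symm ha hx).trans (.of_adj hxb hx hb)

/-- For neighbours of `x`, being adjacent is the same as being joined in `G[S] - x`. The criterion
is local, so cut-vertices of a branch can be compared with those of `G`. -/
lemma LocallyBlock.mem_cutVertices [Finite V] (hG : LocallyBlock G) {S : Set V} {x : V} :
    x ∈ cutVertices G S ↔ x ∈ S ∧ ∃ a ∈ S, ∃ b ∈ S, G.Adj x a ∧ G.Adj x b ∧ a ≠ b ∧
      ¬ G.Adj a b := by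
  rw [mem_cutVertices_iff_joined]
  refine and_congr_right fun hx => ⟨?_, ?_⟩
  · rintro ⟨a, ha, b, hb, hxa, hxb, hj⟩
    refine ⟨a, ha, b, hb, hxa, hxb, ?_, ?_⟩
    · rintro rfl
      exact hj .refl
    · intro hab
      exact hj (.of_adj hab ⟨ha, hxa.ne'⟩ ⟨hb, hxb.ne'⟩)
  · rintro ⟨a, ha, b, hb, hxa, hxb, hne, hab⟩
    exact ⟨a, ha, b, hb, hxa, hxb, fun hj => hab (hG x a b hxa hxb hne (hj.mono fun _ h => h.2))⟩

/-- On a walk from `a`, if `a` is adjacent to `x` but not to the next vertex `y`, then `x` has two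
non-adjacent neighbours and is a cut-vertex. -/
lemma LocallyBlock.isTwoConnected_iff [Finite V] (hG : LocallyBlock G) {T : Set V} :
    IsTwoConnected G T ↔ T.Nonempty ∧ G.IsClique T := by
  constructor
  · rintro ⟨hc, hcut⟩
    refine ⟨Set.nonempty_coe_sort.1 hc.nonempty, ?_⟩
    have hj := preconnected_induce_iff_joined.1 hc.preconnected
    intro a ha b hb
    have := hj a ha b hb
    clear hb
    induction this with
    | refl => exact fun h => absurd rfl h
    | @tail x y _ hxy ih =>
      intro hay
      by_cases hax : a = x
      · exact hax ▸ hxy.1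
      · by_contra hno
        have : x ∈ cutVertices G T :=
          hG.mem_cutVertices.2 ⟨hxy.2.1, a, ha, y, hxy.2.2, (ih hax).symm, hxy.1, hay, hno⟩
        rw [hcut] at this
        exact this
  · rintro ⟨hne, hT⟩
    have : Nonempty T := hne.to_subtype
    refine ⟨SimpleGraph.Connected.mk (preconnected_induce_iff_joined.2 ?_), ?_⟩
    · intro x hx y hy
      by_cases hxy : x = y
      · exact hxy ▸ .refl
      · exact .of_adj (hT hx hy hxy) hx hy
    · refine Set.eq_empty_iff_forall_notMem.2 fun x hx => ?_
      obtain ⟨-, a, ha, b, hb, -, -, hne, hab⟩ := hG.mem_cutVertices.1 hx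
      exact hab (hT ha hb hne)

lemma LocallyBlock.mem_blocks [Finite V] (hG : LocallyBlock G) {S B : Set V} :
    B ∈ blocks G S ↔ Maximal (fun T : Set V => T ⊆ S ∧ T.Nonempty ∧ G.IsClique T) B := by
  have : (fun T : Set V => T ⊆ S ∧ T.Nonempty ∧ G.IsClique T) =
      fun T : Set V => T ⊆ S ∧ IsTwoConnected G T := by
    ext T
    rw [hG.isTwoConnected_iff]
  rw [this]
  exact Iff.rfl

lemma LocallyBlock.block_adj [Finite V] (hG : LocallyBlock G) {S B : Set V} (hB : B ∈ blocks G S)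
    {x y : V} (hx : x ∈ B) (hy : y ∈ B) (hxy : x ≠ y) : G.Adj x y :=
  (hG.mem_blocks.1 hB).prop.2.2 hx hy hxy

lemma LocallyBlock.block_mem [Finite V] (hG : LocallyBlock G) {S B : Set V} (hB : B ∈ blocks G S)
    {u v w : V} (hu : u ∈ B) (hv : v ∈ B) (huv : u ≠ v) (hw : w ∈ S) (huw : G.Adj u w)
    (hvw : G.Adj v w) : w ∈ B := by
  have hM := hG.mem_blocks.1 hB
  refine hM.le_of_ge (y := insert w B) ⟨?_, ⟨w, by simp⟩, ?_⟩ (Set.subset_insert _ _) (by simp)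
  · exact Set.insert_subset hw hM.prop.1
  · refine hM.prop.2.2.insert fun z hz hwz => ?_
    by_cases hzu : z = u
    · exact hzu ▸ huw.symm
    by_cases hzv : z = v
    · exact hzv ▸ hvw.symm
    · refine hG u w z huw (hG.block_adj hB hu hz (Ne.symm hzu)) hwz ?_
      exact (Joined.of_adj hvw.symm huw.ne' huv.symm).tail (hG.block_adj hB hv hz (Ne.symm hzv))
        huv.symm hzu

lemma LocallyBlock.block_mem_of_joined [Finite V] (hG : LocallyBlock G) {B : Set V}
    (hB : B ∈ blocks G Set.univ) {u v w : V} (hu : u ∈ B) (hv : v ∈ B) (huv : u ≠ v)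
    (huw : G.Adj u w) (hj : Joined G {u}ᶜ v w) : w ∈ B := by
  by_cases hvw : v = w
  · exact hvw ▸ hv
  · exact hG.block_mem hB hu hv huv trivial huw (hG u v w (hG.block_adj hB hu hv huv) huw hvw hj)

lemma LocallyBlock.exists_block [Finite V] (hG : LocallyBlock G) {S : Set V} {u v : V}
    (hu : u ∈ S) (hv : v ∈ S) (h : G.Adj u v) : ∃ B ∈ blocks G S, u ∈ B ∧ v ∈ B := by
  obtain ⟨B, hle, hB⟩ :=
    (Set.toFinite {T : Set V | T ⊆ S ∧ T.Nonempty ∧ G.IsClique T}).exists_le_maximal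
      (a := {u, v}) ⟨by rintro x (rfl | rfl) <;> assumption, ⟨u, by simp⟩, by
        rintro x (rfl | rfl) y (rfl | rfl) hxy
        · exact absurd rfl hxy
        · exact h
        · exact h.symm
        · exact absurd rfl hxy⟩
  exact ⟨B, hG.mem_blocks.2 hB, hle (by simp), hle (by simp)⟩

lemma LocallyBlock.block_unique [Finite V] (hG : LocallyBlock G) {S B B' : Set V}
    (hB : B ∈ blocks G S) (hB' : B' ∈ blocks G S) {u v : V} (hu : u ∈ B) (hv : v ∈ B)
    (hu' : u ∈ B') (hv' : v ∈ B') (huv : u ≠ v) : B = B' := by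
  have key : ∀ B B', B ∈ blocks G S → B' ∈ blocks G S → u ∈ B → v ∈ B → u ∈ B' → v ∈ B' →
      B ⊆ B' := by
    intro B B' hB hB' hu hv hu' hv' w hw
    by_cases hwu : w = u
    · exact hwu ▸ hu'
    by_cases hwv : w = v
    · exact hwv ▸ hv'
    · exact hG.block_mem hB' hu' hv' huv ((hG.mem_blocks.1 hB).prop.1 hw)
        (hG.block_adj hB hu hw (Ne.symm hwu)) (hG.block_adj hB hv hw (Ne.symm hwv))
  exact (key B B' hB hB' hu hv hu' hv').antisymm (key B' B hB' hB hu' hv' hu hv)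

end Blocks

/-! ## The branches of a block graph -/

section Sides

variable {V : Type*} {G : SimpleGraph V}

/-- The vertices that are joined in `G - u` to a neighbour of `u` in `A`. -/
def side (G : SimpleGraph V) (u : V) (A : Set V) : Set V :=
  {x | ∃ w ∈ A, G.Adj u w ∧ Joined G {u}ᶜ w x}

lemma notMem_side (u : V) (A : Set V) : u ∉ side G u A := by
  rintro ⟨w, -, huw, hj⟩
  exact hj.mem huw.ne' rfl

lemma mem_side_of_adj {u w : V} {A : Set V} (hw : w ∈ A) (h : G.Adj u w) : w ∈ side G u A :=
  ⟨w, hw, h, .refl⟩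

lemma side_closed {u x z : V} {A : Set V} (hx : x ∈ side G u A) (hxz : G.Adj x z) (hz : z ≠ u) :
    z ∈ side G u A := by
  obtain ⟨w, hw, huw, hj⟩ := hx
  exact ⟨w, hw, huw, hj.tail hxz (hj.mem huw.ne') hz⟩

lemma side_mono {u : V} {A A' : Set V} (h : ∀ w ∈ A, w ≠ u → w ∈ A') :
    side G u A ⊆ side G u A' := by
  rintro x ⟨w, hw, huw, hj⟩
  exact ⟨w, h w hw huw.ne', huw, hj⟩

/-- Stated for any `P` so that both kinds of branches are covered: `P = B` gives `G[B, u]` and `P =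
Bᶜ` gives `G[u, B]`. -/
lemma reachable_deleteEdges_iff {u x : V} {P : Set V} :
    (G.deleteEdges {e | ∃ v, v ∉ P ∧ e = s(u, v)}).Reachable u x ↔ x ∈ insert u (side G u P) := by
  constructor
  · intro h
    rw [SimpleGraph.reachable_iff_reflTransGen] at h
    induction h with
    | refl => simp
    | @tail y z _ hyz ih =>
      rw [SimpleGraph.deleteEdges_adj] at hyz
      obtain ⟨hyz, hd⟩ := hyz
      by_cases hzu : z = u
      · simp [hzu]
      refine Or.inr ?_
      rcases ih with rfl | hy
      · refine mem_side_of_adj ?_ hyz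
        by_contra hz
        exact hd ⟨z, hz, rfl⟩
      · exact side_closed hy hyz hzu
  · rintro (rfl | ⟨w, hw, huw, hj⟩)
    · exact .refl _
    · have h1 : (G.deleteEdges {e | ∃ v, v ∉ P ∧ e = s(u, v)}).Adj u w := by
        rw [SimpleGraph.deleteEdges_adj]
        refine ⟨huw, ?_⟩
        rintro ⟨v, hv, he⟩
        rw [Sym2.congr_right] at he
        exact hv (he ▸ hw)
      refine h1.reachable.trans ?_
      clear h1 huw hw
      induction hj with
      | refl => exact .refl _
      | @tail y z _ hyz ih =>
        refine ih.trans (SimpleGraph.Adj.reachable ?_)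
        rw [SimpleGraph.deleteEdges_adj]
        refine ⟨hyz.1, ?_⟩
        rintro ⟨v, hv, he⟩
        have hmem : u ∈ s(y, z) := by rw [he]; simp
        rcases Sym2.mem_iff.1 hmem with rfl | rfl
        · exact hyz.2.1 rfl
        · exact hyz.2.2 rfl

lemma branch_toVertex (B : Set V) (u : V) :
    branch G (.toVertex B u) = insert u (side G u B) := by
  ext x
  exact reachable_deleteEdges_iff

lemma branch_toBlock (B : Set V) (u : V) :
    branch G (.toBlock u B) = insert u (side G u Bᶜ) := by
  ext x
  rw [← reachable_deleteEdges_iff]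
  simp only [Set.mem_compl_iff, not_not]
  exact Iff.rfl

variable [Finite V]

section

variable (hG : LocallyBlock G) {B B' : Set V} {u v x z : V}

include hG

lemma LocallyBlock.exists_mem_block_ne (hB : B ∈ blocks G Set.univ)
    (huv : G.Adj u v) : ∃ w ∈ B, w ≠ u := by
  by_contra! hno
  have hM := hG.mem_blocks.1 hB
  obtain ⟨B', hB', hu', hv'⟩ := hG.exists_block (Set.mem_univ u) (Set.mem_univ v) huv
  exact huv.ne' (hno v (hM.le_of_ge (hG.mem_blocks.1 hB').prop
    (fun w hw => (hno w hw).symm ▸ hu') hv'))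

lemma LocallyBlock.mem_of_adj_of_notMem_cutVertices (hB : B ∈ blocks G Set.univ) (hu : u ∈ B)
    (hcut : u ∉ cutVertices G Set.univ) (huv : G.Adj u v) : v ∈ B := by
  obtain ⟨w, hw, hwu⟩ := hG.exists_mem_block_ne hB huv
  by_cases hwv : w = v
  · exact hwv ▸ hw
  have huw := hG.block_adj hB hu hw hwu.symm
  refine hG.block_mem hB hu hw hwu.symm trivial huv ?_
  by_contra hno
  exact hcut (hG.mem_cutVertices.2 ⟨trivial, w, trivial, v, trivial, huw, huv, hwv, hno⟩)

lemma LocallyBlock.mem_of_mem_side (hB : B ∈ blocks G Set.univ) (hu : u ∈ B)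
    (hx : x ∈ side G u B) (hux : G.Adj u x) : x ∈ B := by
  obtain ⟨w, hw, huw, hj⟩ := hx
  exact hG.block_mem_of_joined hB hu hw huw.ne hux hj

lemma LocallyBlock.notMem_side_compl (hB : B ∈ blocks G Set.univ) (hu : u ∈ B) (hx : x ∈ B) :
    x ∉ side G u Bᶜ := by
  intro hxs
  have hxu : x ≠ u := by
    rintro rfl
    exact notMem_side _ _ hxs
  obtain ⟨w, hw, huw, hj⟩ := hxs
  exact hw (hG.block_mem_of_joined hB hu hx hxu.symm huw hj.symm)

lemma LocallyBlock.disjoint_side (hB : B ∈ blocks G Set.univ) (hB' : B' ∈ blocks G Set.univ)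
    (hu : u ∈ B) (hu' : u ∈ B') (hne : B ≠ B') (hx : x ∈ side G u B) : x ∉ side G u B' := by
  rintro ⟨w', hw', huw', hj'⟩
  obtain ⟨w, hw, huw, hj⟩ := hx
  exact hne (hG.block_unique hB hB' hu
    (hG.block_mem_of_joined hB hu hw huw.ne huw' (hj.trans hj'.symm)) hu' hw' huw'.ne)

lemma LocallyBlock.side_compl_subset (hB : B ∈ blocks G Set.univ) (hu : u ∈ B) (hv : v ∈ B)
    (huv : u ≠ v) : side G v Bᶜ ⊆ side G u B := by
  rintro x ⟨w, hw, hvw, hj⟩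
  have hvs : v ∈ side G u B := mem_side_of_adj hv (hG.block_adj hB hu hv huv)
  have huw : w ≠ u := by
    rintro rfl
    exact hw hu
  refine (((hj.closed (X := side G v Bᶜ) (mem_side_of_adj hw hvw)
    (fun p hp q hq hpq => side_closed hp hpq hq)).1.mono Set.inter_subset_left).closed
    (side_closed hvs hvw huw) ?_).2
  intro p hp q hq hpq
  refine side_closed hp hpq ?_
  rintro rfl
  exact hG.notMem_side_compl hB hv hu hq

/-- Parts that hang at different vertices of one block do not meet: otherwise a walk that avoids `u`
would bring a neighbour of `v`, and then `v` itself, into the part that hangs at `u`, which contains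
no vertex of `B`. -/
lemma LocallyBlock.disjoint_side_compl (hB : B ∈ blocks G Set.univ) (hu : u ∈ B) (hv : v ∈ B)
    (huv : u ≠ v) (hx : x ∈ side G u Bᶜ) : x ∉ side G v Bᶜ := by
  rintro ⟨w, hw, hvw, hj⟩
  have h1 := (hj.closed (X := side G v Bᶜ) (mem_side_of_adj hw hvw)
    (fun p hp q hq hpq => side_closed hp hpq hq)).1.mono Set.inter_subset_left
  have h2 : w ∈ side G u Bᶜ := by
    refine (h1.symm.closed hx ?_).2
    intro p hp q hq hpq
    refine side_closed hp hpq ?_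
    rintro rfl
    exact hG.notMem_side_compl hB hv hu hq
  exact hG.notMem_side_compl hB hu hv (side_closed h2 hvw.symm huv.symm)

lemma LocallyBlock.mem_kappa (hB : B ∈ blocks G Set.univ) (hu : u ∈ B) :
    v ∈ kappa G B u ↔ v ∈ B ∧ v ≠ u ∧ v ∈ cutVertices G Set.univ := by
  constructor
  · intro hv
    refine ⟨hv.1, ?_, ?_⟩
    · rintro rfl
      exact base_notMem_kappa hB hu hv
    · obtain ⟨-, a, -, b, -, h⟩ := hG.mem_cutVertices.1 hv.2
      exact hG.mem_cutVertices.2 ⟨trivial, a, trivial, b, trivial, h⟩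
  · rintro ⟨hv, hvu, hcut⟩
    refine ⟨hv, ?_⟩
    obtain ⟨-, a, -, b, -, h⟩ := hG.mem_cutVertices.1 hcut
    rw [branch_toVertex]
    have hvs : v ∈ side G u B := mem_side_of_adj hv (hG.block_adj hB hu hv hvu.symm)
    have hnb : ∀ a, G.Adj v a → a ∈ insert u (side G u B) := by
      intro a hva
      by_cases hau : a = u
      · exact Or.inl hau
      · exact Or.inr (side_closed hvs hva hau)
    exact hG.mem_cutVertices.2 ⟨Or.inr hvs, a, hnb a h.1, b, hnb b h.2.1, h⟩

/-- That `u` is a cut-vertex matters: it supplies a neighbour outside `B`, which excludes the block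
`{u}` of a branch that consists of `u` alone. -/
lemma LocallyBlock.mem_beta (hB : B ∈ blocks G Set.univ) (hu : u ∈ B)
    (hcut : u ∈ cutVertices G Set.univ) :
    B' ∈ beta G u B ↔ B' ∈ blocks G Set.univ ∧ u ∈ B' ∧ B' ≠ B := by
  have hbr := branch_toBlock (G := G) B u
  have hus : u ∈ branch G (.toBlock u B) := by rw [hbr]; simp
  constructor
  · rintro ⟨hB', hu'⟩
    have hM := hG.mem_blocks.1 hB'
    obtain ⟨a, hua, haB⟩ : ∃ a, G.Adj u a ∧ a ∉ B := by
      obtain ⟨-, a, -, b, -, hua, hub, hab, hno⟩ := hG.mem_cutVertices.1 hcut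
      by_cases haB : a ∈ B
      · exact ⟨b, hub, fun hbB => hno (hG.block_adj hB haB hbB hab)⟩
      · exact ⟨a, hua, haB⟩
    obtain ⟨w, hw, hwu⟩ : ∃ w ∈ B', w ≠ u := by
      by_contra! hno
      have has : a ∈ branch G (.toBlock u B) := by
        rw [hbr]; exact Or.inr (mem_side_of_adj haB hua)
      obtain ⟨B'', hB'', hu'', ha''⟩ := hG.exists_block hus has hua
      exact hua.ne' (hno a (hM.le_of_ge (hG.mem_blocks.1 hB'').prop
        (fun w hw => (hno w hw).symm ▸ hu'') ha''))
    have huw := hG.block_adj hB' hu' hw hwu.symm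
    have hwB : w ∉ B := by
      intro hwB
      have := hM.prop.1 hw
      rw [hbr] at this
      exact hG.notMem_side_compl hB hu hwB (this.resolve_left hwu)
    obtain ⟨B'', hB'', hu'', hw''⟩ := hG.exists_block (Set.mem_univ u) (Set.mem_univ w) huw
    have hsub : B'' ⊆ branch G (.toBlock u B) := by
      intro z hz
      rw [hbr]
      by_cases hzu : z = u
      · exact Or.inl hzu
      refine Or.inr (mem_side_of_adj ?_ (hG.block_adj hB'' hu'' hz (Ne.symm hzu)))
      intro hzB
      by_cases hzw : z = w
      · exact hwB (hzw ▸ hzB)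
      · exact hwB (hG.block_mem hB hu hzB (Ne.symm hzu) trivial huw
          (hG.block_adj hB'' hz hw'' hzw))
    have hle : B' ⊆ B'' := by
      intro z hz
      by_cases hzu : z = u
      · exact hzu ▸ hu''
      by_cases hzw : z = w
      · exact hzw ▸ hw''
      · exact hG.block_mem hB'' hu'' hw'' hwu.symm trivial
          (hG.block_adj hB' hu' hz (Ne.symm hzu)) (hG.block_adj hB' hw hz (Ne.symm hzw))
    have heq : B' = B'' :=
      hle.antisymm (hM.le_of_ge ⟨hsub, (hG.mem_blocks.1 hB'').prop.2⟩ hle)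
    exact ⟨heq ▸ hB'', hu', fun h => hwB (h ▸ hw)⟩
  · rintro ⟨hB', hu', hne⟩
    refine ⟨?_, hu'⟩
    have hM := hG.mem_blocks.1 hB'
    refine hG.mem_blocks.2 ⟨⟨?_, hM.prop.2⟩, fun T hT hle => hM.le_of_ge ⟨Set.subset_univ _, hT.2⟩ hle⟩
    intro z hz
    rw [hbr]
    by_cases hzu : z = u
    · exact Or.inl hzu
    · refine Or.inr (mem_side_of_adj ?_ (hG.block_adj hB' hu' hz (Ne.symm hzu)))
      exact fun hzB => hne (hG.block_unique hB' hB hu' hz hu hzB (Ne.symm hzu))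

lemma LocallyBlock.side_subset_side_compl (hB : B ∈ blocks G Set.univ) (hu : u ∈ B)
    (hB' : B' ∈ blocks G Set.univ) (hu' : u ∈ B') (hne : B' ≠ B) :
    side G u B' ⊆ side G u Bᶜ :=
  side_mono fun _ hw hwu hwB => hne (hG.block_unique hB' hB hu' hw hu hwB hwu.symm)

end

end Sides

/-! ## Capacities -/

section Capacity

variable {V : Type*} {G : SimpleGraph V}

/-- The vertices of `G[p]` other than the base of `p`. -/
def Arc.side (G : SimpleGraph V) : Arc V → Set V
  | .toVertex B u => TokenSliding.side G u B
  | .toBlock u B => TokenSliding.side G u Bᶜ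

lemma branch_eq_insert (p : Arc V) : branch G p = insert p.base (p.side G) := by
  cases p with
  | toVertex B u => exact branch_toVertex B u
  | toBlock u B => exact branch_toBlock B u

lemma ncard_eq_one_of_indep {B C : Set V} {u x : V} (hB : G.IsClique B) (hC : G.IsIndepSet C)
    (hx : x ∈ B) (hxC : x ∈ C) (hxu : x ≠ u) : (B ∩ (C \ {u})).ncard = 1 := by
  rw [Set.ncard_eq_one]
  refine ⟨x, Set.Subset.antisymm ?_ ?_⟩
  · rintro y ⟨hy, hyC, -⟩
    by_contra hne
    exact indep_iff.1 hC y hyC x hxC (hB hy hx hne)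
  · rintro y rfl
    exact ⟨hx, hxC, hxu⟩

variable [Finite V]

lemma LocallyBlock.toBlock_mem_arcs (hG : LocallyBlock G) {B : Set V} {u v : V}
    (h : Arc.toVertex B u ∈ arcs G) (hv : v ∈ kappa G B u) : Arc.toBlock v B ∈ arcs G := by
  have := (hG.mem_kappa h.2.1 h.2.2).1 hv
  exact ⟨this.2.2, h.2.1, this.1⟩

lemma LocallyBlock.toVertex_mem_arcs (hG : LocallyBlock G) {B B' : Set V} {u : V}
    (h : Arc.toBlock u B ∈ arcs G) (hB' : B' ∈ beta G u B) : Arc.toVertex B' u ∈ arcs G := by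
  have := (hG.mem_beta h.2.1 h.2.2 h.1).1 hB'
  exact ⟨h.1, this.1, this.2.1⟩

lemma not_ua_toVertex {B : Set V} {u : V} (h : Arc.toVertex B u ∈ arcs G) :
    ¬ ua G (.toVertex B u) ↔
      (kappa G B u).Nonempty ∧ (∀ v ∈ kappa G B u, ua G (.toBlock v B)) ∧
        B = kappa G B u ∪ {u} := by
  rw [ua, exists_prop_of_true h, not_or, not_not, Subtype.forall, Set.nonempty_iff_ne_empty]

lemma ua_toBlock {B : Set V} {u : V} (h : Arc.toBlock u B ∈ arcs G) :
    ua G (.toBlock u B) ↔ ∃ B' ∈ beta G u B, ua G (.toVertex B' u) := by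
  rw [ua, exists_prop_of_true h, Subtype.exists]
  simp only [exists_prop]

lemma uaNum_of_ua {p : Arc V} (h : ua G p) : uaNum G p = 1 := if_pos h

lemma uaNum_of_not_ua {p : Arc V} (h : ¬ ua G p) : uaNum G p = 0 := if_neg h

lemma uaNum_nonneg (p : Arc V) : 0 ≤ uaNum G p := by
  unfold uaNum; split_ifs <;> simp

/-- The capacity depends only on the tokens in `G[p]` other than the one at the base. -/
lemma LocallyBlock.cap_congr (hG : LocallyBlock G) {p : Arc V} {C C' : Set V}
    (h : ∀ x ∈ p.side G, x ∈ C ↔ x ∈ C') : cap G p C = cap G p C' := by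
  induction hn : rank G p using Nat.strong_induction_on generalizing p C C' with
  | _ n IH =>
  subst hn
  cases p with
  | toVertex B u =>
    rw [cap, cap]
    split_ifs with harc
    · have e1 : B ∩ (C \ {u}) = B ∩ (C' \ {u}) := by
        ext x
        simp only [Set.mem_inter_iff, Set.mem_sdiff, Set.mem_singleton_iff]
        refine and_congr_right fun hx => ?_
        by_cases hxu : x = u
        · simp [hxu]
        · simp only [hxu, not_false_eq_true, and_true]
          exact h x (mem_side_of_adj hx (hG.block_adj harc.2.1 harc.2.2 hx (Ne.symm hxu)))
      rw [e1]
      congr 2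
      refine finsum_congr fun v => IH _ (rank_toBlock_lt harc v.2) ?_ rfl
      intro x hx
      have hv := (hG.mem_kappa harc.2.1 harc.2.2).1 v.2
      have := h x (hG.side_compl_subset harc.2.1 harc.2.2 hv.1 hv.2.1.symm hx)
      simp [this]
    · rfl
  | toBlock u B =>
    by_cases harc : Arc.toBlock u B ∈ arcs G
    · have e : ∀ B' : beta G u B, cap G (.toVertex B'.1 u) (C ∩ branch G (.toVertex B'.1 u)) =
          cap G (.toVertex B'.1 u) (C' ∩ branch G (.toVertex B'.1 u)) := by
        intro B'
        refine IH _ (rank_toVertex_lt harc B'.2) ?_ rfl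
        intro x hx
        have hB' := (hG.mem_beta harc.2.1 harc.2.2 harc.1).1 B'.2
        have := h x (hG.side_subset_side_compl harc.2.1 harc.2.2 hB'.1 hB'.2.1 hB'.2.2 hx)
        simp [this]
      rw [cap, cap, dif_pos harc, dif_pos harc]
      simp only [e]
      congr 1
      exact propext (exists_congr fun B' => by rw [e B'])
    · rw [cap, cap, dif_neg harc, dif_neg harc]

lemma LocallyBlock.cap_inter_branch (hG : LocallyBlock G) (p : Arc V) (C : Set V) :
    cap G p (C ∩ branch G p) = cap G p C := by
  refine hG.cap_congr fun x hx => ?_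
  simp [branch_eq_insert, hx]

lemma LocallyBlock.cap_toVertex (hG : LocallyBlock G) {B C : Set V} {u : V}
    (h : Arc.toVertex B u ∈ arcs G) :
    cap G (.toVertex B u) C = (∑ᶠ v : kappa G B u, cap G (.toBlock v.1 B) C)
      + uaNum G (.toVertex B u) - ((B ∩ (C \ {u})).ncard : ℤ) := by
  rw [cap, dif_pos h]
  simp only [hG.cap_inter_branch]

lemma LocallyBlock.cap_toBlock_of_full (hG : LocallyBlock G) {B B' C : Set V} {u : V}
    (h : Arc.toBlock u B ∈ arcs G) (hB' : B' ∈ beta G u B)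
    (hcap : cap G (.toVertex B' u) C = 0) (hua : ua G (.toVertex B' u)) :
    cap G (.toBlock u B) C = 0 := by
  rw [cap, dif_pos h]
  exact if_pos ⟨⟨B', hB'⟩, (hG.cap_inter_branch _ _).trans hcap, hua⟩

lemma LocallyBlock.cap_toBlock_of_not_full (hG : LocallyBlock G) {B C : Set V} {u : V}
    (h : Arc.toBlock u B ∈ arcs G)
    (hfull : ∀ B' ∈ beta G u B, cap G (.toVertex B' u) C = 0 → ¬ ua G (.toVertex B' u)) :
    cap G (.toBlock u B) C = (∑ᶠ B' : beta G u B,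
        (cap G (.toVertex B'.1 u) C - uaNum G (.toVertex B'.1 u)))
        + uaNum G (.toBlock u B) := by
  rw [cap, dif_pos h, if_neg]
  · simp only [hG.cap_inter_branch]
  · rintro ⟨B', h1, h2⟩
    exact hfull B'.1 B'.2 ((hG.cap_inter_branch _ _).symm.trans h1) h2

lemma finsum_eq_add_sub {ι : Type*} [Finite ι] {f g : ι → ℤ} (i : ι)
    (h : ∀ j, j ≠ i → f j = g j) : ∑ᶠ j, f j = ∑ᶠ j, g j + f i - g i := by
  classical
  have := Fintype.ofFinite ι
  rw [finsum_eq_sum_of_fintype, finsum_eq_sum_of_fintype,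
    ← Finset.add_sum_erase _ f (Finset.mem_univ i), ← Finset.add_sum_erase _ g (Finset.mem_univ i),
    Finset.sum_congr rfl fun j hj => h j (Finset.ne_of_mem_erase hj)]
  ring

lemma ncard_eq_zero_of_indep {B C : Set V} {u : V} (hB : G.IsClique B) (hC : G.IsIndepSet C)
    (hu : u ∈ B) (huC : u ∈ C) : (B ∩ (C \ {u})).ncard = 0 := by
  rw [Set.ncard_eq_zero, Set.eq_empty_iff_forall_notMem]
  rintro x ⟨hx, hxC, hxu⟩
  exact indep_iff.1 hC u huC x hxC (hB hu hx (Ne.symm hxu))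

/-- Only the term for a token `x` in `B`, other than the base, is negative. It is paid for by `ua(B,
u)` if this is true. If not, `x` is a cut-vertex for which `ua(x, B)` is true, and since `x` is
occupied, the arc `(x, B)` contributes at least one. -/
theorem LocallyBlock.cap_nonneg (hG : LocallyBlock G) {p : Arc V} {C : Set V}
    (hC : G.IsIndepSet C) : 0 ≤ cap G p C := by
  induction hn : rank G p using Nat.strong_induction_on generalizing p with
  | _ n IH =>
  subst hn
  by_cases harc : p ∈ arcs G
  swap
  · cases p with
    | toVertex B u => rw [cap, dif_neg harc]
    | toBlock u B => rw [cap, dif_neg harc]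
  cases p with
  | toVertex B u =>
    have hcl : G.IsClique B := (hG.mem_blocks.1 harc.2.1).prop.2.2
    rw [hG.cap_toVertex harc]
    have hge : ∀ v : kappa G B u, 0 ≤ cap G (.toBlock v.1 B) C := fun v =>
      IH _ (rank_toBlock_lt harc v.2) rfl
    have hsum := finsum_nonneg hge
    have hua := uaNum_nonneg (G := G) (.toVertex B u)
    by_cases hx : ∃ x ∈ B, x ∈ C ∧ x ≠ u
    · obtain ⟨x, hxB, hxC, hxu⟩ := hx
      rw [ncard_eq_one_of_indep hcl hC hxB hxC hxu]
      by_cases h : ua G (.toVertex B u)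
      · rw [uaNum_of_ua h]
        push_cast
        linarith
      · obtain ⟨-, hall, heq⟩ := (not_ua_toVertex harc).1 h
        have hxk : x ∈ kappa G B u := by
          rw [heq] at hxB
          exact hxB.resolve_right hxu
        have harc' := hG.toBlock_mem_arcs harc hxk
        -- The token on `x` keeps the rest of `B'` empty, so nothing is subtracted in the capacity
        -- of `(B', x)`; its summands are nonnegative by induction two levels down.
        have hB' : ∀ B' ∈ beta G x B, uaNum G (.toVertex B' x) ≤ cap G (.toVertex B' x) C := by
          intro B' hB'
          have harc'' := hG.toVertex_mem_arcs harc' hB'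
          have hcl' : G.IsClique B' := (hG.mem_blocks.1 harc''.2.1).prop.2.2
          have hxB' : x ∈ B' := harc''.2.2
          rw [hG.cap_toVertex harc'', ncard_eq_zero_of_indep hcl' hC hxB' hxC]
          have : 0 ≤ ∑ᶠ v : kappa G B' x, cap G (.toBlock v.1 B') C := finsum_nonneg fun v =>
            IH _ (((rank_toBlock_lt harc'' v.2).trans (rank_toVertex_lt harc' hB')).trans
              (rank_toBlock_lt harc hxk)) rfl
          push_cast
          linarith
        have h1 : 1 ≤ cap G (.toBlock x B) C := by
          rw [hG.cap_toBlock_of_not_full harc', uaNum_of_ua (hall x hxk)]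
          · have : 0 ≤ ∑ᶠ B' : beta G x B,
                (cap G (.toVertex B'.1 x) C - uaNum G (.toVertex B'.1 x)) :=
              finsum_nonneg fun B' => sub_nonneg.2 (hB' B'.1 B'.2)
            linarith
          · intro B' hB'' hcap hua'
            have := hB' B' hB''
            rw [hcap, uaNum_of_ua hua'] at this
            norm_num at this
        have h2 : cap G (.toBlock x B) C ≤ ∑ᶠ v : kappa G B u, cap G (.toBlock v.1 B) C :=
          single_le_finsum (⟨x, hxk⟩ : kappa G B u) (Set.toFinite _) hge
        push_cast
        linarith
    · have : B ∩ (C \ {u}) = ∅ := by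
        push Not at hx
        ext x
        have := hx x
        simp only [Set.mem_inter_iff, Set.mem_sdiff, Set.mem_singleton_iff, Set.mem_empty_iff_false]
        tauto
      rw [this, Set.ncard_empty]
      push_cast
      linarith
  | toBlock u B =>
    by_cases hfull : ∃ B' ∈ beta G u B, cap G (.toVertex B' u) C = 0 ∧ ua G (.toVertex B' u)
    · obtain ⟨B', hB', h1, h2⟩ := hfull
      rw [hG.cap_toBlock_of_full harc hB' h1 h2]
    · push Not at hfull
      rw [hG.cap_toBlock_of_not_full harc hfull]
      refine add_nonneg (finsum_nonneg fun B' => ?_) (uaNum_nonneg _)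
      have h1 := IH _ (rank_toVertex_lt harc B'.2) rfl
      by_cases h : ua G (.toVertex B'.1 u)
      · rw [uaNum_of_ua h]
        have h2 : cap G (.toVertex B'.1 u) C ≠ 0 := fun h0 => hfull B'.1 B'.2 h0 h
        omega
      · rw [uaNum_of_not_ua h]
        omega

end Capacity

/-! ## Pushing tokens away from the base of a branch -/

section Push

variable {V : Type*} {G : SimpleGraph V}

/-- By slides in `G[p] - u`, all neighbours of the base `u` of `p` in `G[p]` can be cleared without
changing the capacity. -/
def Clearable (G : SimpleGraph V) [Finite V] (p : Arc V) (C : Set V) : Prop :=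
  ∃ C', Reach G (p.side G) C C' ∧ cap G p C' = cap G p C ∧ ∀ x ∈ C', x ∈ p.side G → ¬ G.Adj p.base x

/-- By slides in `G[p]`, the token at the base of `p` can be moved away, which decreases the
capacity by one. -/
def Absorbable (G : SimpleGraph V) [Finite V] (p : Arc V) (C : Set V) : Prop :=
  ∃ C', Reach G (insert p.base (p.side G)) C C' ∧ p.base ∉ C' ∧ cap G p C' = cap G p C - 1

variable [Finite V]

lemma Clearable.of_base_mem {p : Arc V} {C : Set V} (hC : G.IsIndepSet C) (hp : p.base ∈ C) :
    Clearable G p C :=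
  ⟨C, .refl, rfl, fun _ hx _ => indep_iff.1 hC _ hp _ hx⟩

/-- A token slides within a block to a vertex `v` that has no other occupied neighbours. -/
lemma LocallyBlock.slideIn_block (hG : LocallyBlock G) {B C X : Set V} {t v : V}
    (hB : B ∈ blocks G Set.univ) (hC : G.IsIndepSet C) (htC : t ∈ C) (ht : t ∈ B) (hv : v ∈ B)
    (htv : t ≠ v) (hclear : ∀ x ∈ C, x ∈ side G v Bᶜ → ¬ G.Adj v x) (htX : t ∈ X) (hvX : v ∈ X) :
    SlideIn G X C (insert v (C \ {t})) := by
  have hadj := hG.block_adj hB ht hv htv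
  have hC' := indep_iff.1 hC
  refine ⟨hC, ?_, t, htC, v, fun hvC => hC' t htC v hvC hadj, htX, hvX, hadj, rfl⟩
  have h : ∀ x ∈ C \ {t}, ¬ G.Adj v x := by
    intro x hx hvx
    by_cases hxB : x ∈ B
    · exact hC' x hx.1 t htC (hG.block_adj hB hxB ht hx.2)
    · exact hclear x hx.1 (mem_side_of_adj hxB hvx) hvx
  rw [indep_iff]
  rintro x (rfl | hx) y (rfl | hy) hxy
  · exact hxy.ne rfl
  · exact h y hy hxy
  · exact h x hx hxy.symm
  · exact hC' x hx.1 y hy.1 hxy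

/-- The token in `B` is moved to a vertex `v` whose outer branch has positive capacity, and is
swallowed there. The loss of one in the capacity of `(v, B)` is balanced by the token that
disappears from `B`. -/
lemma LocallyBlock.clearable_toVertex (hG : LocallyBlock G) {B C : Set V} {u : V}
    (harc : Arc.toVertex B u ∈ arcs G) (hC : G.IsIndepSet C)
    (h1 : ∀ v ∈ kappa G B u, ∀ C, G.IsIndepSet C → 1 ≤ cap G (.toBlock v B) C →
      Clearable G (.toBlock v B) C)
    (h2 : ∀ v ∈ kappa G B u, ∀ C, G.IsIndepSet C → v ∈ C → 1 ≤ cap G (.toBlock v B) C →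
      Absorbable G (.toBlock v B) C)
    (h : ¬ ua G (.toVertex B u) ∨ 1 ≤ cap G (.toVertex B u) C) :
    Clearable G (.toVertex B u) C := by
  have hB : B ∈ blocks G Set.univ := harc.2.1
  have hu : u ∈ B := harc.2.2
  have hcl : G.IsClique B := (hG.mem_blocks.1 hB).prop.2.2
  by_cases huC : u ∈ C
  · exact Clearable.of_base_mem hC huC
  by_cases hx : ∃ x ∈ B, x ∈ C
  swap
  · push Not at hx
    exact ⟨C, .refl, rfl, fun x hxC hxs hux => hx x (hG.mem_of_mem_side hB hu hxs hux) hxC⟩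
  obtain ⟨x, hxB, hxC⟩ := hx
  have hxu : x ≠ u := by
    rintro rfl
    exact huC hxC
  -- If all outer branches had capacity zero, the capacity of `(B, u)` would be `ua(B, u) - 1`:
  -- negative if `ua` is false, and zero, against `h`, if it is true.
  obtain ⟨v, hv, hcap⟩ : ∃ v ∈ kappa G B u, 1 ≤ cap G (.toBlock v B) C := by
    by_contra! hno
    have hz : ∀ v : kappa G B u, cap G (.toBlock v.1 B) C = 0 := by
      intro v
      have h1 := hno v.1 v.2
      have h2 := hG.cap_nonneg (p := .toBlock v.1 B) hC
      omega
    have hc := hG.cap_toVertex (C := C) harc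
    rw [ncard_eq_one_of_indep hcl hC hxB hxC hxu, finsum_congr hz, finsum_zero] at hc
    have h0 := hG.cap_nonneg (p := .toVertex B u) hC
    by_cases hua : ua G (.toVertex B u)
    · rw [uaNum_of_ua hua] at hc
      have := h.resolve_left (not_not.2 hua)
      push_cast at hc
      omega
    · rw [uaNum_of_not_ua hua] at hc
      push_cast at hc
      omega
  obtain ⟨hvB, hvu, -⟩ := (hG.mem_kappa hB hu).1 hv
  have hBs : ∀ z ∈ B, z ≠ u → z ∈ side G u B := fun z hz hzu =>
    mem_side_of_adj hz (hG.block_adj hB hu hz (Ne.symm hzu))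
  have hsub : side G v Bᶜ ⊆ side G u B := hG.side_compl_subset hB hu hvB hvu.symm
  have hBside : ∀ z ∈ B, z ∉ side G v Bᶜ := fun z hz => hG.notMem_side_compl hB hvB hz
  obtain ⟨C₁, hr1, hc1, hclear⟩ := h1 v hv C hC hcap
  simp only [Arc.side, Arc.base] at hr1 hclear
  have hC1 := hr1.indep hC
  have hxC1 : x ∈ C₁ := (hr1.mem_iff (hBside x hxB)).1 hxC
  obtain ⟨C₂, hr2, hvC2, hagree2⟩ : ∃ C₂, Reach G (side G u B) C₁ C₂ ∧ v ∈ C₂ ∧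
      ∀ z, z ∉ B → (z ∈ C₁ ↔ z ∈ C₂) := by
    by_cases hxv : x = v
    · exact ⟨C₁, .refl, hxv ▸ hxC1, fun _ _ => Iff.rfl⟩
    · refine ⟨insert v (C₁ \ {x}), (hG.slideIn_block hB hC1 hxC1 hxB hvB hxv hclear (hBs x hxB hxu)
        (hBs v hvB hvu)).reach, by simp, ?_⟩
      intro z hz
      have hzv : z ≠ v := fun h => hz (h ▸ hvB)
      have hzx : z ≠ x := fun h => hz (h ▸ hxB)
      simp [hzv, hzx]
  have hC2 := hr2.indep hC1
  have hsideB : ∀ w ∈ B, ∀ z ∈ side G w Bᶜ, z ∉ B := fun w hw z hz hzB =>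
    hG.notMem_side_compl hB hw hzB hz
  have hc2 : cap G (.toBlock v B) C₂ = cap G (.toBlock v B) C := by
    rw [← hc1]
    exact (hG.cap_congr (p := .toBlock v B) fun z hz => hagree2 z (hsideB v hvB z hz)).symm
  obtain ⟨C₃, hr3, hvC3, hc3⟩ := h2 v hv C₂ hC2 hvC2 (hc2.symm ▸ hcap)
  simp only [Arc.side, Arc.base] at hr3 hvC3
  have hBC3 : ∀ z ∈ B, z ∉ C₃ := by
    intro z hz hzC
    by_cases hzv : z = v
    · exact hvC3 (hzv ▸ hzC)
    · have hz' : z ∈ C₂ := (hr3.mem_iff (by simp [hzv, hBside z hz])).2 hzC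
      exact indep_iff.1 hC2 z hz' v hvC2 (hG.block_adj hB hz hvB hzv)
  refine ⟨C₃, ((hr1.mono hsub).trans hr2).trans (hr3.mono ?_), ?_, ?_⟩
  · rintro z (rfl | hz)
    · exact hBs _ hvB hvu
    · exact hsub hz
  · have hsum := finsum_eq_add_sub (f := fun w : kappa G B u => cap G (.toBlock w.1 B) C₃)
      (g := fun w : kappa G B u => cap G (.toBlock w.1 B) C) ⟨v, hv⟩ (by
        rintro ⟨w, hw⟩ hwv
        have hwv : w ≠ v := fun h => hwv (Subtype.ext h)
        obtain ⟨hwB, -, -⟩ := (hG.mem_kappa hB hu).1 hw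
        refine hG.cap_congr fun z hz => ?_
        have hzv := hG.disjoint_side_compl hB hwB hvB hwv hz
        have hzB := hsideB w hwB z hz
        rw [hr1.mem_iff hzv, hagree2 z hzB]
        refine (hr3.mem_iff ?_).symm
        rintro (rfl | hz')
        · exact hzB hvB
        · exact hzv hz')
    have e1 : (B ∩ (C₃ \ {u})).ncard = 0 := by
      rw [Set.ncard_eq_zero, Set.eq_empty_iff_forall_notMem]
      rintro z ⟨hz, hzC, -⟩
      exact hBC3 z hz hzC
    rw [hG.cap_toVertex harc, hG.cap_toVertex harc, ncard_eq_one_of_indep hcl hC hxB hxC hxu, e1,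
      hsum]
    simp only [hc3, hc2]
    push_cast
    ring
  · intro z hzC hzs huz
    exact hBC3 z (hG.mem_of_mem_side hB hu hzs huz) hzC

/-- The token slides from `u` to some `w` in `B` whose neighbours outside `B` can be cleared first.
Clearing keeps the outer capacities, so the only change is the new token in `B`, which costs one. -/
lemma LocallyBlock.absorbable_toVertex (hG : LocallyBlock G) {B C : Set V} {u : V}
    (harc : Arc.toVertex B u ∈ arcs G) (hC : G.IsIndepSet C) (huC : u ∈ C)
    (h1 : ∀ v ∈ kappa G B u, ∀ C, G.IsIndepSet C →
      (¬ ua G (.toBlock v B) ∨ 1 ≤ cap G (.toBlock v B) C) → Clearable G (.toBlock v B) C)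
    (h : 1 ≤ cap G (.toVertex B u) C) : Absorbable G (.toVertex B u) C := by
  have hB : B ∈ blocks G Set.univ := harc.2.1
  have hu : u ∈ B := harc.2.2
  have hcut : u ∈ cutVertices G Set.univ := harc.1
  have hcl : G.IsClique B := (hG.mem_blocks.1 hB).prop.2.2
  have hcap := hG.cap_toVertex (C := C) harc
  rw [ncard_eq_zero_of_indep hcl hC hu huC] at hcap
  -- If no `w` were suitable, every other vertex of `B` would be a cut-vertex with `ua` true and
  -- capacity zero. Then `ua(B, u)` is false and the capacity of `(B, u)` vanishes.
  obtain ⟨w, hwB, hwu, hw⟩ : ∃ w ∈ B, w ≠ u ∧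
      (w ∈ kappa G B u → ¬ ua G (.toBlock w B) ∨ 1 ≤ cap G (.toBlock w B) C) := by
    by_contra! hno
    have hz : ∀ v : kappa G B u, cap G (.toBlock v.1 B) C = 0 := by
      intro v
      have hv := (hG.mem_kappa hB hu).1 v.2
      have h1 := (hno v.1 hv.1 hv.2.1).2.2
      have h2 := hG.cap_nonneg (p := .toBlock v.1 B) hC
      omega
    rw [finsum_congr hz, finsum_zero] at hcap
    have hua : ¬ ua G (.toVertex B u) := by
      obtain ⟨-, a, -, b, -, hua, -⟩ := hG.mem_cutVertices.1 hcut
      obtain ⟨w, hw, hwu⟩ := hG.exists_mem_block_ne hB hua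
      refine (not_ua_toVertex harc).2 ⟨⟨w, (hno w hw hwu).1⟩, ?_, ?_⟩
      · intro v hv
        have hv' := (hG.mem_kappa hB hu).1 hv
        exact (hno v hv'.1 hv'.2.1).2.1
      · ext z
        constructor
        · intro hz
          by_cases hzu : z = u
          · exact Or.inr hzu
          · exact Or.inl (hno z hz hzu).1
        · rintro (hz | rfl)
          · exact hz.1
          · exact hu
    rw [uaNum_of_not_ua hua] at hcap
    push_cast at hcap
    omega
  have hBside : ∀ z ∈ B, z ∉ side G w Bᶜ := fun z hz => hG.notMem_side_compl hB hwB hz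
  obtain ⟨C₁, hr1, hc1, hclear⟩ : ∃ C₁, Reach G (side G w Bᶜ) C C₁ ∧
      (w ∈ kappa G B u → cap G (.toBlock w B) C₁ = cap G (.toBlock w B) C) ∧
      ∀ x ∈ C₁, x ∈ side G w Bᶜ → ¬ G.Adj w x := by
    by_cases hwk : w ∈ kappa G B u
    · obtain ⟨C₁, hr1, hc1, hclear⟩ := h1 w hwk C hC (hw hwk)
      exact ⟨C₁, hr1, fun _ => hc1, hclear⟩
    · refine ⟨C, .refl, fun _ => rfl, fun x _ hxs hwx => ?_⟩
      have hwcut : w ∉ cutVertices G Set.univ := fun h =>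
        hwk ((hG.mem_kappa hB hu).2 ⟨hwB, hwu, h⟩)
      exact hBside x (hG.mem_of_adj_of_notMem_cutVertices hB hwB hwcut hwx) hxs
  have hC1 := hr1.indep hC
  have huC1 : u ∈ C₁ := (hr1.mem_iff (hBside u hu)).1 huC
  have hws : w ∈ side G u B := mem_side_of_adj hwB (hG.block_adj hB hu hwB hwu.symm)
  have hs := hG.slideIn_block (X := insert u (side G u B)) hB hC1 huC1 hu hwB hwu.symm hclear
    (by simp) (Or.inr hws)
  have hC2 := hs.2.1
  refine ⟨insert w (C₁ \ {u}), (hr1.mono ?_).trans hs.reach, ?_, ?_⟩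
  · exact (hG.side_compl_subset hB hu hwB hwu.symm).trans (Set.subset_insert _ _)
  · simp [Arc.base, hwu.symm]
  · have hsum : ∀ v : kappa G B u, cap G (.toBlock v.1 B) (insert w (C₁ \ {u})) =
        cap G (.toBlock v.1 B) C := by
      rintro ⟨v, hv⟩
      obtain ⟨hvB, hvu, -⟩ := (hG.mem_kappa hB hu).1 hv
      have e : cap G (.toBlock v B) (insert w (C₁ \ {u})) = cap G (.toBlock v B) C₁ := by
        refine hG.cap_congr fun z hz => ?_
        have hzw : z ≠ w := by
          rintro rfl
          exact hG.notMem_side_compl hB hvB hwB hz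
        have hzu : z ≠ u := by
          rintro rfl
          exact hG.notMem_side_compl hB hvB hu hz
        simp [hzw, hzu]
      rw [e]
      by_cases hvw : v = w
      · subst hvw
        exact hc1 hv
      · exact (hG.cap_congr (p := .toBlock v B) fun z hz =>
          hr1.mem_iff (hG.disjoint_side_compl hB hvB hwB hvw hz)).symm
    rw [hcap, hG.cap_toVertex harc, finsum_congr hsum,
      ncard_eq_one_of_indep hcl hC2 hwB (by simp) hwu]
    push_cast
    ring

/-- The neighbours of `u` in several blocks can be cleared simultaneously. -/
lemma LocallyBlock.clearable_toBlock (hG : LocallyBlock G) {B C : Set V} {u : V}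
    (harc : Arc.toBlock u B ∈ arcs G) (hC : G.IsIndepSet C)
    (h1 : ∀ B' ∈ beta G u B, ∀ C, G.IsIndepSet C →
      (¬ ua G (.toVertex B' u) ∨ 1 ≤ cap G (.toVertex B' u) C) → Clearable G (.toVertex B' u) C)
    (h : ¬ ua G (.toBlock u B) ∨ 1 ≤ cap G (.toBlock u B) C) : Clearable G (.toBlock u B) C := by
  have hB : B ∈ blocks G Set.univ := harc.2.1
  have hu : u ∈ B := harc.2.2
  have hcut : u ∈ cutVertices G Set.univ := harc.1
  have hblock : ∀ B' ∈ beta G u B, ¬ ua G (.toVertex B' u) ∨ 1 ≤ cap G (.toVertex B' u) C := by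
    intro B' hB'
    by_contra! hno
    have h0 := hG.cap_nonneg (p := .toVertex B' u) hC
    rcases h with h | h
    · exact h ((ua_toBlock harc).2 ⟨B', hB', hno.1⟩)
    · rw [hG.cap_toBlock_of_full harc hB' (by omega) hno.1] at h
      norm_num at h
  -- Slides on the side of one block do not touch the sides of the other blocks, so their capacities
  -- and earlier clearings persist.
  have key : ∀ F : Set (Set V), F.Finite → F ⊆ beta G u B → ∃ C', Reach G (side G u Bᶜ) C C' ∧
      (∀ B' ∈ beta G u B, cap G (.toVertex B' u) C' = cap G (.toVertex B' u) C) ∧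
      ∀ B' ∈ F, ∀ x ∈ C', x ∈ side G u B' → ¬ G.Adj u x := by
    intro F hF
    induction F, hF using Set.Finite.induction_on with
    | empty => exact fun _ => ⟨C, .refl, fun _ _ => rfl, by simp⟩
    | @insert B₀ F hB0 _ ih =>
      intro hsub
      obtain ⟨C', hr, hc, hclear⟩ := ih ((Set.subset_insert _ _).trans hsub)
      have hB0b := hsub (Set.mem_insert _ _)
      obtain ⟨hB0', hu0, hne0⟩ := (hG.mem_beta hB hu hcut).1 hB0b
      obtain ⟨C'', hr', hc', hclear'⟩ := h1 B₀ hB0b C' (hr.indep hC) (by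
        rw [hc B₀ hB0b]
        exact hblock B₀ hB0b)
      simp only [Arc.side, Arc.base] at hr' hclear'
      have hagree : ∀ B' ∈ beta G u B, B' ≠ B₀ → ∀ x ∈ side G u B', x ∈ C' ↔ x ∈ C'' := by
        intro B' hB' hne x hx
        obtain ⟨hB'', hu', -⟩ := (hG.mem_beta hB hu hcut).1 hB'
        exact hr'.mem_iff (hG.disjoint_side hB'' hB0' hu' hu0 hne hx)
      refine ⟨C'', hr.trans (hr'.mono (hG.side_subset_side_compl hB hu hB0' hu0 hne0)), ?_, ?_⟩
      · intro B' hB'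
        by_cases hne : B' = B₀
        · rw [hne, hc', hc B₀ hB0b]
        · rw [← hc B' hB']
          exact (hG.cap_congr (p := .toVertex B' u) (hagree B' hB' hne)).symm
      · rintro B' (rfl | hB') x hxC hxs
        · exact hclear' x hxC hxs
        · have hne : B' ≠ B₀ := by
            rintro rfl
            exact hB0 hB'
          exact hclear B' hB' x ((hagree B' (hsub (Or.inr hB')) hne x hxs).2 hxC) hxs
  obtain ⟨C', hr, hc, hclear⟩ := key _ (Set.toFinite (beta G u B)) subset_rfl
  refine ⟨C', hr, ?_, ?_⟩
  · by_cases hfull : ∃ B' ∈ beta G u B, cap G (.toVertex B' u) C = 0 ∧ ua G (.toVertex B' u)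
    · obtain ⟨B', hB', h1, h2⟩ := hfull
      rw [hG.cap_toBlock_of_full harc hB' h1 h2,
        hG.cap_toBlock_of_full harc hB' ((hc B' hB').trans h1) h2]
    · push Not at hfull
      rw [hG.cap_toBlock_of_not_full harc hfull, hG.cap_toBlock_of_not_full harc fun B' hB' h0 =>
        hfull B' hB' ((hc B' hB').symm.trans h0)]
      rw [finsum_congr fun B' : beta G u B => by rw [hc B'.1 B'.2]]
  · intro x hxC hxs hux
    have hux : G.Adj u x := hux
    obtain ⟨B', hB', hu', hx'⟩ := hG.exists_block (Set.mem_univ u) (Set.mem_univ x) hux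
    have hne : B' ≠ B := by
      rintro rfl
      exact hG.notMem_side_compl hB hu hx' hxs
    exact hclear B' ((hG.mem_beta hB hu hcut).2 ⟨hB', hu', hne⟩) x hxC (mem_side_of_adj hx' hux) hux

/-- A block whose capacity exceeds its `ua` is preferred: it can take the token without becoming
full, and its summand drops by one. Only if there is none is a block with `ua` true filled up. -/
lemma LocallyBlock.absorbable_toBlock (hG : LocallyBlock G) {B C : Set V} {u : V}
    (harc : Arc.toBlock u B ∈ arcs G) (hC : G.IsIndepSet C) (huC : u ∈ C)
    (h2 : ∀ B' ∈ beta G u B, 1 ≤ cap G (.toVertex B' u) C → Absorbable G (.toVertex B' u) C)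
    (h : 1 ≤ cap G (.toBlock u B) C) : Absorbable G (.toBlock u B) C := by
  have hB : B ∈ blocks G Set.univ := harc.2.1
  have hu : u ∈ B := harc.2.2
  have hcut : u ∈ cutVertices G Set.univ := harc.1
  have hfull : ∀ B' ∈ beta G u B, cap G (.toVertex B' u) C = 0 → ¬ ua G (.toVertex B' u) := by
    intro B' hB' h0 hua
    rw [hG.cap_toBlock_of_full harc hB' h0 hua] at h
    norm_num at h
  have hge : ∀ B' ∈ beta G u B, uaNum G (.toVertex B' u) ≤ cap G (.toVertex B' u) C := by
    intro B' hB'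
    have h0 := hG.cap_nonneg (p := .toVertex B' u) hC
    by_cases hua : ua G (.toVertex B' u)
    · have : cap G (.toVertex B' u) C ≠ 0 := fun h0 => hfull B' hB' h0 hua
      rw [uaNum_of_ua hua]
      omega
    · rwa [uaNum_of_not_ua hua]
  have hcapC := hG.cap_toBlock_of_not_full harc hfull
  -- absorbing the token in the block `B₀`
  have absorb : ∀ B₀ ∈ beta G u B, 1 ≤ cap G (.toVertex B₀ u) C →
      ∃ C', Reach G (insert u (side G u Bᶜ)) C C' ∧ u ∉ C' ∧
        cap G (.toVertex B₀ u) C' = cap G (.toVertex B₀ u) C - 1 ∧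
        ∀ B' ∈ beta G u B, B' ≠ B₀ → cap G (.toVertex B' u) C' = cap G (.toVertex B' u) C := by
    intro B₀ hB0 hcap
    obtain ⟨C', hr, huC', hc⟩ := h2 B₀ hB0 hcap
    simp only [Arc.side, Arc.base] at hr huC'
    obtain ⟨hB0', hu0, hne0⟩ := (hG.mem_beta hB hu hcut).1 hB0
    refine ⟨C', hr.mono (Set.insert_subset_insert
      (hG.side_subset_side_compl hB hu hB0' hu0 hne0)), huC', hc, ?_⟩
    intro B' hB' hne
    obtain ⟨hB'', hu', -⟩ := (hG.mem_beta hB hu hcut).1 hB'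
    refine (hG.cap_congr fun x hx => hr.mem_iff ?_).symm
    rintro (rfl | hx0)
    · exact notMem_side _ _ hx
    · exact hG.disjoint_side hB'' hB0' hu' hu0 hne hx hx0
  by_cases hex : ∃ B₀ ∈ beta G u B, 1 ≤ cap G (.toVertex B₀ u) C - uaNum G (.toVertex B₀ u)
  · obtain ⟨B₀, hB0, hcap0⟩ := hex
    obtain ⟨C', hr, huC', hc0, hc⟩ := absorb B₀ hB0 (by
      have := uaNum_nonneg (G := G) (.toVertex B₀ u)
      omega)
    refine ⟨C', hr, huC', ?_⟩
    rw [hcapC, hG.cap_toBlock_of_not_full harc, finsum_eq_add_sub (ι := beta G u B)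
      (f := fun B' => cap G (.toVertex B'.1 u) C' - uaNum G (.toVertex B'.1 u))
      (g := fun B' => cap G (.toVertex B'.1 u) C - uaNum G (.toVertex B'.1 u)) ⟨B₀, hB0⟩]
    · simp only [hc0]
      ring
    · rintro ⟨B', hB'⟩ hne
      simp only
      rw [hc B' hB' fun h => hne (Subtype.ext h)]
    · intro B' hB' h0 hua
      by_cases hne : B' = B₀
      · subst hne
        rw [uaNum_of_ua hua] at hcap0
        omega
      · rw [hc B' hB' hne] at h0
        exact hfull B' hB' h0 hua
  · push Not at hex
    have hz : ∀ B' : beta G u B,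
        cap G (.toVertex B'.1 u) C - uaNum G (.toVertex B'.1 u) = 0 := by
      intro B'
      have h1 := hex B'.1 B'.2
      have h2 := hge B'.1 B'.2
      omega
    rw [finsum_congr hz, finsum_zero, zero_add] at hcapC
    have hua : ua G (.toBlock u B) := by
      by_contra hno
      rw [uaNum_of_not_ua hno] at hcapC
      omega
    -- Now the total capacity is exactly one. The chosen block drops from one to zero, and the first
    -- case in the definition of `cap` makes the total zero.
    obtain ⟨B₀, hB0, hua0⟩ := (ua_toBlock harc).1 hua
    have h1 := hz ⟨B₀, hB0⟩
    simp only [uaNum_of_ua hua0] at h1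
    obtain ⟨C', hr, huC', hc0, -⟩ := absorb B₀ hB0 (by omega)
    refine ⟨C', hr, huC', ?_⟩
    rw [hcapC, hG.cap_toBlock_of_full harc hB0 (by omega) hua0, uaNum_of_ua hua]
    norm_num

/-- The two properties need each other along the block-tree: clearing at a block uses both at the
arcs `(v, B)`, while absorbing uses clearing there to make room. -/
theorem LocallyBlock.clearable_and_absorbable (hG : LocallyBlock G) {p : Arc V}
    (harc : p ∈ arcs G) :
    (∀ C, G.IsIndepSet C → (¬ ua G p ∨ 1 ≤ cap G p C) → Clearable G p C) ∧
    (∀ C, G.IsIndepSet C → p.base ∈ C → 1 ≤ cap G p C → Absorbable G p C) := by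
  induction hn : rank G p using Nat.strong_induction_on generalizing p with
  | _ n IH =>
  subst hn
  cases p with
  | toVertex B u =>
    have IH' : ∀ v ∈ kappa G B u, _ := fun v hv =>
      IH _ (rank_toBlock_lt harc hv) (hG.toBlock_mem_arcs harc hv) rfl
    exact ⟨fun C hC h => hG.clearable_toVertex harc hC
        (fun v hv C hC h => (IH' v hv).1 C hC (Or.inr h)) (fun v hv => (IH' v hv).2) h,
      fun C hC huC h => hG.absorbable_toVertex harc hC huC (fun v hv => (IH' v hv).1) h⟩
  | toBlock u B =>
    have IH' : ∀ B' ∈ beta G u B, _ := fun B' hB' =>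
      IH _ (rank_toVertex_lt harc hB') (hG.toVertex_mem_arcs harc hB') rfl
    exact ⟨fun C hC h => hG.clearable_toBlock harc hC (fun B' hB' => (IH' B' hB').1) h,
      fun C hC huC h => hG.absorbable_toBlock harc hC huC
        (fun B' hB' => (IH' B' hB').2 C hC huC) h⟩

end Push

/-! ## Rigid vertices -/

section Rigid

variable {V : Type*} [Finite V] {G : SimpleGraph V}

lemma LocallyBlock.potValues_toVertex (hG : LocallyBlock G) {C : Set V} (hC : G.IsIndepSet C)
    (B : Set V) (u : V) : potValues G C (.toVertex B u) = {x | ∃ C', Reach G Set.univ C C' ∧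
      x = cap G (.toVertex B u) C' + ((C' ∩ side G u B).ncard : ℤ)
        - ((C ∩ side G u B).ncard : ℤ)} := by
  have e : ∀ D : Set V, (D ∩ branch G (.toVertex B u)) \ {u} = D ∩ side G u B := by
    intro D
    ext x
    have := notMem_side (G := G) u B
    simp only [branch_toVertex]
    grind
  ext x
  simp only [potValues, Set.mem_ofPred_eq, reachableFrom_iff hC, hG.cap_inter_branch, Arc.base, e]

lemma LocallyBlock.le_pot (hG : LocallyBlock G) {C C' : Set V} (hC : G.IsIndepSet C)
    (h : Reach G Set.univ C C') (B : Set V) (u : V) :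
    cap G (.toVertex B u) C' + ((C' ∩ side G u B).ncard : ℤ) - ((C ∩ side G u B).ncard : ℤ) ≤
      pot G C (.toVertex B u) := by
  refine (isGreatest_pot G hC _).2 ?_
  rw [hG.potValues_toVertex hC]
  exact ⟨C', h, rfl⟩

lemma LocallyBlock.exists_eq_pot (hG : LocallyBlock G) {C : Set V} (hC : G.IsIndepSet C)
    (B : Set V) (u : V) : ∃ C', Reach G Set.univ C C' ∧
      pot G C (.toVertex B u) = cap G (.toVertex B u) C' + ((C' ∩ side G u B).ncard : ℤ)
        - ((C ∩ side G u B).ncard : ℤ) := by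
  have := (isGreatest_pot G hC (.toVertex B u)).1
  rwa [hG.potValues_toVertex hC] at this

/-- If `ua(B, u)` is true and no capacity is left, then the block `B` blocks the vertex `u`. -/
lemma LocallyBlock.notMem_of_cap_le_zero (hG : LocallyBlock G) {B C : Set V} {u : V}
    (harc : Arc.toVertex B u ∈ arcs G) (hua : ua G (.toVertex B u)) (hC : G.IsIndepSet C)
    (h : cap G (.toVertex B u) C ≤ 0) : u ∉ C := by
  intro huC
  have hcl : G.IsClique B := (hG.mem_blocks.1 harc.2.1).prop.2.2
  have huB : u ∈ B := harc.2.2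
  rw [hG.cap_toVertex harc, uaNum_of_ua hua, ncard_eq_zero_of_indep hcl hC huB huC] at h
  have : 0 ≤ ∑ᶠ v : kappa G B u, cap G (.toBlock v.1 B) C := finsum_nonneg fun v => hG.cap_nonneg hC
  push_cast at h
  omega

/-- A rigid vertex is never occupied. -/
theorem LocallyBlock.rigid_unoccupied (hG : LocallyBlock G) {C D : Set V} {u : V}
    (hC : G.IsIndepSet C) (hu : u ∈ rigid G C) (h : Reach G Set.univ C D) : u ∉ D := by
  obtain ⟨hcut, B, hB, B', hB', huB, huB', hne, hpot, hpot', hua, hua'⟩ := hu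
  have harc : Arc.toVertex B u ∈ arcs G := ⟨hcut, hB, huB⟩
  have harc' : Arc.toVertex B' u ∈ arcs G := ⟨hcut, hB', huB'⟩
  -- The counts on both sides are carried along, because they turn zero potential into a bound on
  -- the current capacity.
  suffices key : u ∉ D ∧ (D ∩ side G u B).ncard = (C ∩ side G u B).ncard ∧
      (D ∩ side G u B').ncard = (C ∩ side G u B').ncard from key.1
  induction h with
  | refl =>
    refine ⟨hG.notMem_of_cap_le_zero harc hua hC ?_, rfl, rfl⟩
    have := hG.le_pot hC .refl B u
    omega
  | @tail D D' hD hs ih =>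
    obtain ⟨huD, hn, hn'⟩ := ih
    have hle := hG.le_pot hC (Reach.trans hD hs.reach) B u
    have hle' := hG.le_pot hC (Reach.trans hD hs.reach) B' u
    obtain ⟨hI, hJ, a, ha, b, hb, -, -, hab, hDD'⟩ := hs
    have hau : a ≠ u := by
      rintro rfl
      exact huD ha
    by_cases hbu : b = u
    · subst hbu
      have hb' : b ∈ D' := by grind
      have hsame : ∀ A, a ∉ side G b A → D' ∩ side G b A = D ∩ side G b A := by
        intro A haA
        have := notMem_side (G := G) b A
        ext x
        grind
      -- The token that enters `u` comes from at most one of the two sides. On the other one the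
      -- count is unchanged, so the capacity is at most zero, which is impossible with `u` occupied.
      by_cases haB : a ∈ side G b B
      · have haB' := hG.disjoint_side hB hB' huB huB' hne haB
        rw [hsame B' haB'] at hle'
        exact absurd hb' (hG.notMem_of_cap_le_zero harc' hua' hJ (by omega))
      · rw [hsame B haB] at hle
        exact absurd hb' (hG.notMem_of_cap_le_zero harc hua hJ (by omega))
    · have hr : Reach G {u}ᶜ D D' :=
        SlideIn.reach ⟨hI, hJ, a, ha, b, hb, hau, hbu, hab, hDD'⟩
      have hcount : ∀ A, (D ∩ side G u A).ncard = (D' ∩ side G u A).ncard := fun A =>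
        hr.ncard_inter fun x hx y hy hxy => side_closed hx hxy hy
      refine ⟨?_, (hcount B).symm.trans hn, (hcount B').symm.trans hn'⟩
      rw [hDD']
      rintro (rfl | hu)
      · exact hbu rfl
      · exact huD hu.1

/-- Both maxima run over the same configurations; only the subtracted count depends on the starting
point. -/
lemma LocallyBlock.pot_eq_of_reach (hG : LocallyBlock G) {C D B : Set V} {u : V}
    (hC : G.IsIndepSet C) (h : Reach G Set.univ C D)
    (hn : (C ∩ side G u B).ncard = (D ∩ side G u B).ncard) :
    pot G D (.toVertex B u) = pot G C (.toVertex B u) := by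
  rw [pot, pot, hG.potValues_toVertex hC, hG.potValues_toVertex (h.indep hC), hn]
  congr 1
  ext x
  exact exists_congr fun E => and_congr_left fun _ => ⟨fun h' => h.trans h', fun h' => h.symm.trans h'⟩

lemma LocallyBlock.rigid_subset_of_reach (hG : LocallyBlock G) {C D : Set V}
    (hC : G.IsIndepSet C) (h : Reach G Set.univ C D) : rigid G C ⊆ rigid G D := by
  intro u hu
  have hr : Reach G (Set.univ ∩ {u}ᶜ) C D := h.restrict fun E hE x hx hxu =>
    hG.rigid_unoccupied hC hu hE (hxu ▸ hx)
  have hpot : ∀ B, pot G D (.toVertex B u) = pot G C (.toVertex B u) := fun B =>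
    hG.pot_eq_of_reach hC h (hr.ncard_inter fun x hx y hy hxy => side_closed hx hxy hy.2)
  obtain ⟨hcut, B, hB, B', hB', huB, huB', hne, h1, h2, h3⟩ := hu
  exact ⟨hcut, B, hB, B', hB', huB, huB', hne, (hpot B).trans h1, (hpot B').trans h2, h3⟩

theorem LocallyBlock.rigid_eq_of_reach (hG : LocallyBlock G) {C D : Set V}
    (hC : G.IsIndepSet C) (h : Reach G Set.univ C D) : rigid G C = rigid G D :=
  (hG.rigid_subset_of_reach hC h).antisymm (hG.rigid_subset_of_reach (h.indep hC) h.symm)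

/-- The neighbourhood of a vertex that is not rigid can be brought to contain at most one token. -/
theorem LocallyBlock.exists_reach_subsingleton (hG : LocallyBlock G) {C : Set V} {u : V}
    (hC : G.IsIndepSet C) (hu : u ∉ rigid G C) :
    ∃ D, Reach G Set.univ C D ∧ (D ∩ closedNbhd G u).Subsingleton := by
  -- If `u` can be occupied, its neighbours are empty at that moment. Otherwise `u` is always empty,
  -- so the sides of the blocks at `u` move independently with constant token counts.
  by_cases hocc : ∃ D, Reach G Set.univ C D ∧ u ∈ D
  · obtain ⟨D, hD, huD⟩ := hocc
    have hDi := indep_iff.1 (hD.indep hC)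
    have key : ∀ x ∈ D ∩ closedNbhd G u, x = u := fun x hx =>
      hx.2.resolve_right (hDi u huD x hx.1)
    exact ⟨D, hD, fun x hx y hy => (key x hx).trans (key y hy).symm⟩
  push Not at hocc
  have hadj : ∀ D, Reach G Set.univ C D → ∀ x ∈ D, x ∈ closedNbhd G u → G.Adj u x :=
    fun D hD x hx hxu => hxu.resolve_left fun h => hocc D hD (h ▸ hx)
  by_cases hcut : u ∈ cutVertices G Set.univ
  swap
  · refine ⟨C, .refl, fun x hx y hy => ?_⟩
    by_contra hne
    exact hcut (hG.mem_cutVertices.2 ⟨trivial, x, trivial, y, trivial, hadj C .refl x hx.1 hx.2,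
      hadj C .refl y hy.1 hy.2, hne, indep_iff.1 hC x hx.1 y hy.1⟩)
  have hcl : ∀ A : Set V, ∀ x ∈ side G u A, ∀ y ∈ ({u}ᶜ : Set V), G.Adj x y → y ∈ side G u A :=
    fun A x hx y hy hxy => side_closed hx hxy hy
  -- independent moves in the branch of the block `B`
  have merge : ∀ D E B, Reach G Set.univ C D → Reach G Set.univ C E →
      Reach G (side G u B) D (E ∩ side G u B ∪ D \ side G u B) := by
    intro D E B hD hE
    have hr : Reach G (Set.univ ∩ {u}ᶜ) D E := (hD.symm.trans hE).restrict fun F hF x hx hxu =>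
      hocc F (hD.trans hF) (hxu ▸ hx)
    have := hr.project (X := side G u B) (Z := D \ side G u B) (fun x hx y hy => hcl B x hx y hy.2)
      ((hD.indep hC).mono Set.sdiff_subset)
      (fun x hx z hz hxz => hz.2 (hcl B x hx z (fun h => hocc D hD (h ▸ hz.1)) hxz))
      (fun z hz => hz.2)
    rw [Set.inter_union_sdiff] at this
    exact this.mono Set.inter_subset_left
  have good : ∀ B ∈ blocks G Set.univ, u ∈ B →
      ¬ (pot G C (.toVertex B u) = 0 ∧ ua G (.toVertex B u)) →
      ∃ D, Reach G Set.univ C D ∧ ∀ x ∈ D, x ∈ side G u B → ¬ G.Adj u x := by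
    intro B hB huB hgood
    have harc : Arc.toVertex B u ∈ arcs G := ⟨hcut, hB, huB⟩
    -- With constant counts the potential is the largest capacity that can be reached; being
    -- nonzero, it is at least one.
    obtain ⟨D, hD, h⟩ : ∃ D, Reach G Set.univ C D ∧
        (¬ ua G (.toVertex B u) ∨ 1 ≤ cap G (.toVertex B u) D) := by
      by_cases hua : ua G (.toVertex B u)
      · obtain ⟨D, hD, hpot⟩ := hG.exists_eq_pot hC B u
        refine ⟨D, hD, Or.inr ?_⟩
        have hr : Reach G (Set.univ ∩ {u}ᶜ) C D := hD.restrict fun F hF x hx hxu =>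
          hocc F hF (hxu ▸ hx)
        rw [hr.ncard_inter fun x hx y hy => hcl B x hx y hy.2] at hpot
        have h0 := hG.cap_nonneg (p := .toVertex B u) (hD.indep hC)
        have h1 : pot G C (.toVertex B u) ≠ 0 := fun h => hgood ⟨h, hua⟩
        omega
      · exact ⟨C, .refl, Or.inl hua⟩
    obtain ⟨E, hE, -, hclear⟩ := (hG.clearable_and_absorbable harc).1 D (hD.indep hC) h
    exact ⟨E, hD.trans (hE.mono (Set.subset_univ _)), hclear⟩
  have key : ∀ F : Set (Set V), F.Finite → F ⊆ {B | B ∈ blocks G Set.univ ∧ u ∈ B ∧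
      ¬ (pot G C (.toVertex B u) = 0 ∧ ua G (.toVertex B u))} →
      ∃ D, Reach G Set.univ C D ∧ ∀ B ∈ F, ∀ x ∈ D, x ∈ side G u B → ¬ G.Adj u x := by
    intro F hF
    induction F, hF using Set.Finite.induction_on with
    | empty => exact fun _ => ⟨C, .refl, by simp⟩
    | @insert B F _ _ ih =>
      intro hsub
      obtain ⟨D, hD, hclear⟩ := ih ((Set.subset_insert _ _).trans hsub)
      obtain ⟨hB, huB, hgood⟩ := hsub (Set.mem_insert _ _)
      obtain ⟨E, hE, hclearE⟩ := good B hB huB hgood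
      refine ⟨_, hD.trans ((merge D E B hD hE).mono (Set.subset_univ _)), ?_⟩
      rintro B' hB' x (hx | hx) hxs
      · exact hclearE x hx.1 hx.2
      · rcases hB' with rfl | hB'
        · exact absurd hxs hx.2
        · exact hclear B' hB' x hx.1 hxs
  -- All blocks are cleared except those with `ua` true and potential zero. As `u` is not rigid, at
  -- most one such block remains, and as a clique it holds at most one token.
  obtain ⟨D, hD, hclear⟩ := key _ (Set.toFinite _) subset_rfl
  refine ⟨D, hD, fun x hx y hy => ?_⟩
  by_contra hne
  have bad : ∀ x ∈ D, G.Adj u x → ∃ B ∈ blocks G Set.univ, u ∈ B ∧ x ∈ B ∧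
      pot G C (.toVertex B u) = 0 ∧ ua G (.toVertex B u) := by
    intro x hx hux
    obtain ⟨B, hB, huB, hxB⟩ := hG.exists_block (Set.mem_univ u) (Set.mem_univ x) hux
    refine ⟨B, hB, huB, hxB, ?_⟩
    by_contra hgood
    exact hclear B ⟨hB, huB, hgood⟩ x hx (mem_side_of_adj hxB hux) hux
  obtain ⟨B, hB, huB, hxB, hpot, hua⟩ := bad x hx.1 (hadj D hD x hx.1 hx.2)
  obtain ⟨B', hB', huB', hyB', hpot', hua'⟩ := bad y hy.1 (hadj D hD y hy.1 hy.2)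
  by_cases hBB : B = B'
  · subst hBB
    exact indep_iff.1 (hD.indep hC) x hx.1 y hy.1 (hG.block_adj hB hxB hyB' hne)
  · exact hu ⟨hcut, B, hB, B', hB', huB, huB', hBB, hpot, hpot', hua, hua'⟩

end Rigid

/-! ## Components of the graph without its rigid vertices -/

section Components

variable {V : Type*} {G : SimpleGraph V}

lemma component_closed {Y : Set V} (H : (G.induce Y).ConnectedComponent) :
    ∀ x ∈ Subtype.val '' H.supp, ∀ y ∈ Y, G.Adj x y → y ∈ Subtype.val '' H.supp := by
  rintro _ ⟨x, hx, rfl⟩ y hy hxy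
  refine ⟨⟨y, hy⟩, ?_, rfl⟩
  rw [SimpleGraph.ConnectedComponent.mem_supp_iff] at hx ⊢
  rw [← hx]
  exact SimpleGraph.ConnectedComponent.eq.2 (SimpleGraph.Adj.reachable (by simpa using hxy.symm))

lemma component_joined {Y : Set V} (H : (G.induce Y).ConnectedComponent) :
    ∀ x ∈ Subtype.val '' H.supp, ∀ y ∈ Subtype.val '' H.supp,
      Joined G (Subtype.val '' H.supp) x y := by
  rintro _ ⟨x, hx, rfl⟩ _ ⟨y, hy, rfl⟩
  have hx' := (SimpleGraph.ConnectedComponent.mem_supp_iff _ _).1 hx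
  have hy' := (SimpleGraph.ConnectedComponent.mem_supp_iff _ _).1 hy
  have h := reachable_induce_iff_joined.1 (SimpleGraph.ConnectedComponent.eq.1 (hx'.trans hy'.symm))
  exact (h.closed (X := Subtype.val '' H.supp) ⟨x, hx, rfl⟩ (component_closed H)).1.mono
    Set.inter_subset_left

/-- If the vertices outside `Y` are never occupied and all vertices of `Y` can be freed of all
but one token in their neighbourhoods, then independent sets that have the same number of tokens
in each component of `G[Y]` are reachable from each other. -/
theorem LocallyBlock.reach_of_components [Finite V] (hG : LocallyBlock G) {Y C₁ C₂ : Set V}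
    (hC₁ : G.IsIndepSet C₁) (hC₂ : G.IsIndepSet C₂)
    (h₁ : ∀ D, Reach G Set.univ C₁ D → D ⊆ Y) (h₂ : ∀ D, Reach G Set.univ C₂ D → D ⊆ Y)
    (hu₁ : ∀ x ∈ Y, ∃ D, Reach G Set.univ C₁ D ∧ (D ∩ closedNbhd G x).Subsingleton)
    (hu₂ : ∀ x ∈ Y, ∃ D, Reach G Set.univ C₂ D ∧ (D ∩ closedNbhd G x).Subsingleton)
    (hcard : ∀ H : (G.induce Y).ConnectedComponent,
      (C₁ ∩ Subtype.val '' H.supp).ncard = (C₂ ∩ Subtype.val '' H.supp).ncard) :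
    Reach G Set.univ C₁ C₂ := by
  have hXY : ∀ H : (G.induce Y).ConnectedComponent, Subtype.val '' H.supp ⊆ Y := by
    rintro H _ ⟨x, -, rfl⟩
    exact x.2
  have unstuck : ∀ C, (∀ D, Reach G Set.univ C D → D ⊆ Y) →
      (∀ x ∈ Y, ∃ D, Reach G Set.univ C D ∧ (D ∩ closedNbhd G x).Subsingleton) →
      ∀ H : (G.induce Y).ConnectedComponent,
        Unstuck G (Subtype.val '' H.supp) (C ∩ Subtype.val '' H.supp) := by
    intro C hCY hu H x hx
    obtain ⟨D, hD, hs⟩ := hu x (hXY H hx)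
    have := (hD.restrict hCY).project (X := Subtype.val '' H.supp) (Z := ∅)
      (fun x hx y hy => component_closed H x hx y hy.2) (by simp [indep_iff]) (by simp) (by simp)
    rw [Set.union_empty, Set.union_empty] at this
    exact ⟨_, this.mono Set.inter_subset_left, hs.anti fun z hz => ⟨hz.1.1, hz.2⟩⟩
  -- The components are converted one at a time from `C₁` to `C₂`; tokens in the other components
  -- stay in place and do not interfere.
  have key : ∀ F : Set (G.induce Y).ConnectedComponent, F.Finite → ∃ D, Reach G Set.univ C₁ D ∧
      ∀ H : (G.induce Y).ConnectedComponent, ∀ x ∈ Subtype.val '' H.supp,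
        (H ∈ F → (x ∈ D ↔ x ∈ C₂)) ∧ (H ∉ F → (x ∈ D ↔ x ∈ C₁)) := by
    intro F hF
    induction F, hF using Set.Finite.induction_on with
    | empty => exact ⟨C₁, .refl, fun H x _ => ⟨fun h => absurd h (by simp), fun _ => Iff.rfl⟩⟩
    | @insert H F hHF _ ih =>
      obtain ⟨D, hD, hDF⟩ := ih
      set X := Subtype.val '' H.supp with hX
      have hr : Reach G X (C₁ ∩ X) (C₂ ∩ X) := Unstuck.reach hG (component_joined H)
        (hC₁.mono Set.inter_subset_left) (hC₂.mono Set.inter_subset_left) Set.inter_subset_right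
        Set.inter_subset_right (hcard H) (unstuck C₁ h₁ hu₁ H) (unstuck C₂ h₂ hu₂ H)
      have hr' := hr.frame (Z := D \ X) Set.inter_subset_right
        ((hD.indep hC₁).mono Set.sdiff_subset)
        (fun x hx z hz hxz => hz.2 (component_closed H x hx z (h₁ D hD hz.1) hxz))
        (fun z hz => hz.2)
      have e : C₁ ∩ X ∪ D \ X = D := by
        ext x
        by_cases hx : x ∈ X
        · simp [hx, (hDF H x hx).2 hHF]
        · simp [hx]
      rw [e] at hr'
      refine ⟨_, hD.trans (hr'.mono (Set.subset_univ _)), ?_⟩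
      intro H' x hx
      by_cases hHH : H' = H
      · subst hHH
        exact ⟨fun _ => by simp [X, hx], fun h => absurd (Set.mem_insert _ _) h⟩
      · have hxX : x ∉ X := by
          intro hxX
          obtain ⟨y, hy, rfl⟩ := hx
          obtain ⟨y', hy', he⟩ := hxX
          rw [Subtype.val_injective he] at hy'
          exact hHH (((SimpleGraph.ConnectedComponent.mem_supp_iff _ _).1 hy).symm.trans
            ((SimpleGraph.ConnectedComponent.mem_supp_iff _ _).1 hy'))
        have := hDF H' x hx
        simpa [hxX, hHH] using this
  obtain ⟨D, hD, hDF⟩ := key Set.univ Set.finite_univ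
  have hDY := h₁ D hD
  have hCY := h₂ C₂ .refl
  have e : D = C₂ := by
    have : ∀ x ∈ Y, x ∈ D ↔ x ∈ C₂ := fun x hx =>
      (hDF ((G.induce Y).connectedComponentMk ⟨x, hx⟩) x ⟨⟨x, hx⟩, rfl, rfl⟩).1 trivial
    ext x
    exact ⟨fun hx => (this x (hDY hx)).1 hx, fun hx => (this x (hCY hx)).2 hx⟩
  exact e ▸ hD

end Components

end TokenSliding

/-! ### The theorem -/

theorem mainTheorem1 {V : Type*} [Finite V] (G : SimpleGraph V)
    (hG : TokenSliding.IsBlockGraph G) (C₁ C₂ W₁ W₂ : Set V)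
    (hC₁ : G.IsIndepSet C₁) (hC₂ : G.IsIndepSet C₂)
    (hW₁ : W₁ = TokenSliding.rigid G C₁) (hW₂ : W₂ = TokenSliding.rigid G C₂) :
    TokenSliding.ReachableFrom G C₂ C₁ ↔
      W₁ = W₂ ∧
        ∀ H : (G.induce W₁ᶜ).ConnectedComponent,
          (C₁ ∩ Subtype.val '' H.supp).ncard = (C₂ ∩ Subtype.val '' H.supp).ncard := by
  have hL := hG.locallyBlock
  rw [TokenSliding.reachableFrom_iff hC₂]
  have hunocc : ∀ C W, G.IsIndepSet C → W = TokenSliding.rigid G C →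
      ∀ D, TokenSliding.Reach G Set.univ C D → D ⊆ Wᶜ := by
    rintro C W hC rfl D hD x hx hxW
    exact hL.rigid_unoccupied hC hxW hD hx
  constructor
  · intro h
    refine ⟨?_, fun H => ?_⟩
    · rw [hW₁, hW₂]
      exact (hL.rigid_eq_of_reach hC₂ h).symm
    · exact (h.symm.restrict (hunocc C₁ W₁ hC₁ hW₁)).ncard_inter fun x hx y hy =>
        TokenSliding.component_closed H x hx y hy.2
  · rintro ⟨hW, hcard⟩
    have hW' : W₁ = TokenSliding.rigid G C₂ := hW.trans hW₂
    exact (hL.reach_of_components hC₁ hC₂ (hunocc C₁ W₁ hC₁ hW₁) (hunocc C₂ W₁ hC₂ hW')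
      (fun x hx => hL.exists_reach_subsingleton hC₁ (hW₁ ▸ hx))
      (fun x hx => hL.exists_reach_subsingleton hC₂ (hW' ▸ hx)) hcard).symm
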